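/- Setup (mean-variance linear bandit). Let $\mathcal A\subset\mathbb R^d$, $d\ge 2$, be a finite set that spans $\mathbb R^d$, with $\|a\|_2\le 1$ for all $a\in\mathcal A$. Let $\rho\ge 0$, $\omega\ge 0$ and $\theta_*,\phi_*\in\mathbb R^d$ with $\|\theta_*\|_2\le 1$ and $\|\phi_*\|_2\le\omega$. Put $\mu_a=\langle a,\theta_*\rangle$ and $\sigma_a^2=f(\langle\phi_*,a\rangle)$, where $f(z)=z+\omega$, and suppose that $\sigma_a^2\le\sigma_{\max}^2$ for all $a\in\mathcal A$. When action $A_t$ is selected in round $t$, the reward $X_t=\mu_{A_t}+\eta_t(A_t)$ is observed, where $\eta_t(a)\sim\mathcal N(0,\sigma_a^2)$ and the noises of different rounds are independent. Let $a_*$ minimize $\sigma_a^2-\rho\mu_a$ over $\mathcal A$, and put $\Delta_a=(\sigma_a^2-\rho\mu_a)-(\sigma_{a_*}^2-\rho\mu_{a_*})$ and $\Gamma_{a,b}=\mu_a-\mu_b$. With $\tau_a(T)$ the number of the first $T$ rounds in which $a$ is selected, the expected intermediate regret is $$\mathbb E[\tilde R(T)]=\sum_{a\in\mathcal A}\mathbb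 E[\tau_a(T)]\,\Delta_a+\frac1T\sum_{a\in\mathcal A}\sum_{b\in\mathcal A,\,b\ne a}\mathbb E[\tau_a(T)\tau_b(T)]\,\Gamma_{a,b}^2 .$$ Algorithm RISE (parameters $\delta,\varepsilon>0$ and a constant $\tilde C>0$). (1) Let $Q^*$ be a probability distribution on $\mathcal A$ with at most $d(d+1)/2$ non-zero entries that minimizes $g(Q)=\max_{a\in\mathcal A}a^\top\bigl(\sum_{b\in\mathcal A}Q(b)bb^\top\bigr)^{-1}a$ over all distributions $Q$ for which the inverse exists. (2) Select each $a\in\mathcal A$ exactly $n_a=\bigl\lceil\tilde C^2d^2\log(d)\log^2(\delta^{-1})\,g(Q^*)Q^*(a)/\varepsilon^2\bigr\rceil$ times, in any fixed order; let $n=\sum_a n_a$ (if $n>T$, this phase is cut off after $T$ rounds). (3) With $V_n=\sum_{s=1}^nA_sA_s^\top$ compute $\hat\theta_n=V_n^{-1}\sum_{s=1}^nX_sA_s$ and $\hat\phi_n=V_n^{-1}\sum_{s=1}^nf^{-1}\bigl((X_s-\langle\hat\theta_n,A_s\rangle)^2\bigr)A_s$. (4) In all remaining rounds select $\hat a^*\in\arg\min_{a\in\mathcal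 A}\langle\hat\phi_n-\rho\hat\theta_n,a\rangle$, ties being broken by any measurable rule. Statement. With $\delta=1/T$ and $\varepsilon=\Theta(dT^{-1/3})$, RISE ensures $\mathbb E[\tilde R(T)]=\tilde O(dT^{2/3})$. Precisely: there is an absolute integer $k\ge 0$ such that for all $\rho\ge 0$, $\sigma_{\max}\ge 0$, $\tilde C>0$ and $0<c_1\le c_2$ there is a constant $C>0$ such that for all $d\ge 2$, all $T\ge 2$, all $\varepsilon$ with $c_1dT^{-1/3}\le\varepsilon\le c_2dT^{-1/3}$ and all instances as above (of any size $|\mathcal A|$), RISE run with $\delta=1/T$ satisfies $$\mathbb E[\tilde R(T)]\le C\,d\,T^{2/3}\,(\log T)^k .$$ -/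

import Mathlib

open MeasureTheory ProbabilityTheory
open scoped RealInnerProductSpace Matrix

noncomputable section

namespace MVBandit

/-- Actions and parameters live in `ℝ^d` with the Euclidean norm. -/
abbrev Vec (d : ℕ) : Type := EuclideanSpace ℝ (Fin d)

/-- A problem instance: a finite set of actions in the unit ball which spans `ℝ^d`, the mean
parameter `θ`, the variance parameter `φ` and the offset `ω` of the variance function. -/
structure Bandit (d : ℕ) where
  actions : Finset (Vec d)
  norm_action_le : ∀ a ∈ actions, ‖a‖ ≤ 1
  span_actions : Submodule.span ℝ (actions : Set (Vec d)) = ⊤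
  ω : ℝ
  θ : Vec d
  φ : Vec d
  norm_θ_le : ‖θ‖ ≤ 1
  norm_φ_le : ‖φ‖ ≤ ω

/-! ### The variance function -/

/-- `f(z) = z + ω`. -/
def varFun (ω z : ℝ) : ℝ := z + ω

/-- The inverse function of `varFun ω`. -/
def varFunInv (ω y : ℝ) : ℝ := y - ω

theorem varFunInv_varFun (ω z : ℝ) : varFunInv ω (varFun ω z) = z := by
  simp [varFunInv, varFun]

theorem varFun_varFunInv (ω y : ℝ) : varFun ω (varFunInv ω y) = y := by
  simp [varFunInv, varFun]

/-! ### Means, variances and gaps -/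

/-- `μ_a = ⟨a, θ⟩`. -/
def Bandit.mean {d : ℕ} (B : Bandit d) (a : B.actions) : ℝ := ⟪(a : Vec d), B.θ⟫

/-- `σ_a² = f(⟨φ, a⟩) = ⟨φ, a⟩ + ω`. -/
def Bandit.var {d : ℕ} (B : Bandit d) (a : B.actions) : ℝ := varFun B.ω ⟪B.φ, (a : Vec d)⟫

/-- The mean-variance `σ_a² - ρ μ_a` of an action. -/
def Bandit.mv {d : ℕ} (B : Bandit d) (ρ : ℝ) (a : B.actions) : ℝ := B.var a - ρ * B.mean a

/-- `Γ_{a,b} = μ_a - μ_b`. -/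
def Bandit.meanDiff {d : ℕ} (B : Bandit d) (a b : B.actions) : ℝ := B.mean a - B.mean b

/-- `Δ_{a,b} = σ_a² - ρ μ_a - (σ_b² - ρ μ_b)`. -/
def Bandit.mvDiff {d : ℕ} (B : Bandit d) (ρ : ℝ) (a b : B.actions) : ℝ :=
  B.mv ρ a - B.mv ρ b

/-! ### Policies and their interaction with the environment

Rounds are numbered `0, 1, 2, …`, so the first `T` rounds are those with `t < T`. -/

/-- A policy chooses the action of round `t` from the actions and rewards of the rounds before
`t`. -/
def Policy {d : ℕ} (𝒜 : Finset (Vec d)) : Type := (t : ℕ) → (Fin t → 𝒜 × ℝ) → 𝒜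

/-- The noise `η_t(a)` is Gaussian with mean zero and variance `σ_a²`, and the noise of
different rounds is independent (within one round the joint law over the actions is arbitrary,
as only one of its entries is ever observed). -/
structure Bandit.IsNoise {d : ℕ} (B : Bandit d) {Ω : Type*} [MeasurableSpace Ω]
    (P : Measure Ω) (η : ℕ → B.actions → Ω → ℝ) : Prop where
  measurable : ∀ t a, Measurable (η t a)
  law : ∀ t a, P.map (η t a) = gaussianReal 0 (B.var a).toNNReal
  indep : iIndepFun (fun t x a => η t a x) P

/-- `A` and `X` are the actions and the rewards when policy `π` is run with the noise `η`:
`A_t` is what `π` prescribes given the history, and `X_t = ⟨A_t, θ⟩ + η_t(A_t)`. These two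
equations determine `A` and `X` recursively. -/
structure Bandit.IsRun {d : ℕ} (B : Bandit d) {Ω : Type*} (η : ℕ → B.actions → Ω → ℝ)
    (π : Policy B.actions) (A : ℕ → Ω → B.actions) (X : ℕ → Ω → ℝ) : Prop where
  action : ∀ t x, A t x = π t (fun s : Fin t => (A s x, X s x))
  reward : ∀ t x, X t x = B.mean (A t x) + η t (A t x) x

open Classical in
/-- `τ_a(T)`, the number of the first `T` rounds in which `a` is selected. -/
def pulls {α Ω : Type*} (A : ℕ → Ω → α) (T : ℕ) (a : α) (x : Ω) : ℝ :=
  ∑ t ∈ Finset.range T, if A t x = a then 1 else 0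

open Classical in
/-- The expected intermediate regret
`∑_a E[τ_a(T)] Δ_a + (1/T) ∑_a ∑_{b ≠ a} E[τ_a(T) τ_b(T)] Γ_{a,b}²`, where `Δ_a = Δ_{a,a*}`. -/
def Bandit.intermediateRegret {d : ℕ} (B : Bandit d) {Ω : Type*} [MeasurableSpace Ω]
    (P : Measure Ω) (ρ : ℝ) (aStar : B.actions) (A : ℕ → Ω → B.actions) (T : ℕ) : ℝ :=
  ∑ a, (∫ x, pulls A T a x ∂P) * B.mvDiff ρ a aStar +
    (1 / (T : ℝ)) * ∑ a, ∑ b ∈ Finset.univ.filter (fun b => b ≠ a),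
      (∫ x, pulls A T a x * pulls A T b x ∂P) * B.meanDiff a b ^ 2

/-! ### The G-optimal design -/

/-- The rank-one matrix `a aᵀ`. -/
def outer {d : ℕ} (a : Vec d) : Matrix (Fin d) (Fin d) ℝ := Matrix.vecMulVec a.ofLp a.ofLp

/-- `∑_a Q(a) a aᵀ`. -/
def designMatrix {d : ℕ} {𝒜 : Finset (Vec d)} (Q : 𝒜 → ℝ) : Matrix (Fin d) (Fin d) ℝ :=
  ∑ a : 𝒜, Q a • outer (a : Vec d)

/-- A design is a probability distribution on the actions; its matrix has to be invertible for
the objective below to be defined. -/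
structure IsDesign {d : ℕ} {𝒜 : Finset (Vec d)} (Q : 𝒜 → ℝ) : Prop where
  nonneg : ∀ a, 0 ≤ Q a
  sum_eq_one : ∑ a, Q a = 1
  isUnit : IsUnit (designMatrix Q)

/-- `g(Q) = max_a aᵀ (∑_b Q(b) b bᵀ)⁻¹ a`. -/
def gValue {d : ℕ} {𝒜 : Finset (Vec d)} (Q : 𝒜 → ℝ) : ℝ :=
  ⨆ a : 𝒜, (a : Vec d).ofLp ⬝ᵥ ((designMatrix Q)⁻¹ *ᵥ (a : Vec d).ofLp)

/-- A minimizer of `g` over all designs that has at most `d(d+1)/2` non-zero entries. -/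
structure IsGOptimal {d : ℕ} {𝒜 : Finset (Vec d)} (Q : 𝒜 → ℝ) : Prop where
  isDesign : IsDesign Q
  le : ∀ Q' : 𝒜 → ℝ, IsDesign Q' → gValue Q ≤ gValue Q'
  card_support_le : (Function.support Q).ncard ≤ d * (d + 1) / 2

/-! ### The RISE algorithm -/

/-- `n_a = ⌈ C² d² log d log²(1/δ) g(Q) Q(a) / ε² ⌉`. -/
def exploreCount {d : ℕ} {𝒜 : Finset (Vec d)} (C δ ε : ℝ) (Q : 𝒜 → ℝ) (a : 𝒜) : ℕ :=
  ⌈C ^ 2 * (d : ℝ) ^ 2 * Real.log d * Real.log δ⁻¹ ^ 2 * gValue Q * Q a / ε ^ 2⌉₊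

/-- The length `n = ∑_a n_a` of the exploration phase. -/
def exploreLength {d : ℕ} {𝒜 : Finset (Vec d)} (C δ ε : ℝ) (Q : 𝒜 → ℝ) : ℕ :=
  ∑ a, exploreCount C δ ε Q a

open Classical in
/-- `e 0, e 1, …, e (n - 1)` is an order in which each action `a` occurs exactly `n_a` times. -/
def IsExploreOrder {d : ℕ} {𝒜 : Finset (Vec d)} (C δ ε : ℝ) (Q : 𝒜 → ℝ) (e : ℕ → 𝒜) : Prop :=
  ∀ a, ((Finset.range (exploreLength C δ ε Q)).filter (fun s => e s = a)).card =
    exploreCount C δ ε Q a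

/-- `V_n = ∑_{s ≤ n} A_s A_sᵀ`. -/
def gram {d n : ℕ} {𝒜 : Finset (Vec d)} (h : Fin n → 𝒜 × ℝ) : Matrix (Fin d) (Fin d) ℝ :=
  ∑ s, outer ((h s).1 : Vec d)

/-- `V_n⁻¹ ∑_{s ≤ n} y_s A_s`. -/
def leastSquares {d n : ℕ} {𝒜 : Finset (Vec d)} (h : Fin n → 𝒜 × ℝ) (y : Fin n → ℝ) : Vec d :=
  WithLp.toLp 2 ((gram h)⁻¹ *ᵥ (∑ s, y s • ((h s).1 : Vec d)).ofLp)

/-- The estimate of the mean parameter, `V_n⁻¹ ∑_{s ≤ n} X_s A_s`. -/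
def thetaHat {d n : ℕ} {𝒜 : Finset (Vec d)} (h : Fin n → 𝒜 × ℝ) : Vec d :=
  leastSquares h (fun s => (h s).2)

/-- The estimate of the variance parameter,
`V_n⁻¹ ∑_{s ≤ n} f⁻¹((X_s - ⟨θ̂_n, A_s⟩)²) A_s`. -/
def phiHat {d n : ℕ} {𝒜 : Finset (Vec d)} (ω : ℝ) (h : Fin n → 𝒜 × ℝ) : Vec d :=
  leastSquares h (fun s => varFunInv ω (((h s).2 - ⟪thetaHat h, ((h s).1 : Vec d)⟫) ^ 2))

/-- A measurable choice of a minimizer of a function on a finite set (a rule for ties). -/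
structure IsArgmin {α : Type*} [MeasurableSpace α] (sel : (α → ℝ) → α) : Prop where
  measurable : Measurable sel
  le : ∀ (v : α → ℝ) (a : α), v (sel v) ≤ v a

/-- The RISE policy: in the first `n` rounds the actions are taken in the order `e`; in every
later round the action minimizing `⟨φ̂_n - ρ θ̂_n, a⟩` is taken, where the estimates are those
from the first `n` rounds. -/
def rise {d : ℕ} {𝒜 : Finset (Vec d)} (ω ρ : ℝ) (n : ℕ) (e : ℕ → 𝒜) (sel : (𝒜 → ℝ) → 𝒜) :
    Policy 𝒜 := fun t h =>
  if ht : t < n then e t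
  else
    let data : Fin n → 𝒜 × ℝ := fun s => h (Fin.castLE (not_lt.mp ht) s)
    sel (fun a => ⟪phiHat ω data - ρ • thetaHat data, (a : Vec d)⟫)

end MVBandit

end

open MeasureTheory ProbabilityTheory
open scoped RealInnerProductSpace Matrix

noncomputable section

namespace MVBandit

/-! RISE explores and then commits, so its regret splits in two (`Bandit.intermediateRegret_le`).
Each of the `n` exploration rounds costs a constant: a pair of rounds enters the `Γ²` term only if
one of them is exploratory, which gives at most `8nT` before the division by `T`. Every later round
costs the gap of the committed action.

Let `N` be `exploreScale`. The optimal design has `g(Q) ≤ d` (Kiefer-Wolfowitz, via a maximizer of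
the determinant), so `n ≤ N d + d²`, while every action has leverage `aᵀV⁻¹a ≤ 1/N ≤ M²`.

The error of a least squares fit in direction `u` is `∑ y_s w_s` with `w_s = v_sᵀV⁻¹u`. The vector
`w` is fixed by the hat matrix `H`, an orthogonal projection of trace `d`, so this is at most `M
‖Hy‖`, and `E‖Hy‖²` is at most `d` times the largest second moment when the `y_s` are centered and
independent. The random factor does not depend on `u`, so one first moment bound serves all actions
at once: neither concentration nor a union bound is needed, and `|𝒜|` never enters. For `φ̂` the
squared residuals `(z - Hz)²` add the non-centered terms `(Hz)² - 2z(Hz)`, which are again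
controlled through `H` (`abs_estimation_error_le`). Hence the expected gap is `O(M d)`.

With `ε` of order `dT^{-1/3}` one may take `M` of order `T^{-1/3}`, and `N d` is at most of order
`dT^{2/3} log³ T` when `d ≤ T^{2/3}`. Otherwise `T ≤ dT^{2/3}`, and the trivial linear bound
suffices. -/

/-! ### Weighted Gram matrices -/

/-- `∑_i c_i v_i v_iᵀ`. -/
def wgram {ι : Type*} [Fintype ι] {d : ℕ} (c : ι → ℝ) (v : ι → Fin d → ℝ) :
    Matrix (Fin d) (Fin d) ℝ := ∑ i, c i • Matrix.vecMulVec (v i) (v i)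

section WGram

variable {ι : Type*} [Fintype ι] {d : ℕ} {c : ι → ℝ} {v : ι → Fin d → ℝ}

theorem wgram_mulVec (c : ι → ℝ) (v : ι → Fin d → ℝ) (x : Fin d → ℝ) :
    wgram c v *ᵥ x = ∑ i, (c i * (v i ⬝ᵥ x)) • v i := by
  simp only [wgram, Matrix.sum_mulVec, Matrix.smul_mulVec, Matrix.vecMulVec_mulVec]
  refine Finset.sum_congr rfl fun i _ => ?_
  ext j
  simp; ring

theorem dotProduct_wgram_mulVec (c : ι → ℝ) (v : ι → Fin d → ℝ) (x y : Fin d → ℝ) :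
    y ⬝ᵥ (wgram c v *ᵥ x) = ∑ i, c i * (v i ⬝ᵥ x) * (v i ⬝ᵥ y) := by
  rw [wgram_mulVec, dotProduct_sum]
  refine Finset.sum_congr rfl fun i _ => ?_
  rw [dotProduct_smul, smul_eq_mul, dotProduct_comm y]

theorem wgram_transpose (c : ι → ℝ) (v : ι → Fin d → ℝ) : (wgram c v)ᵀ = wgram c v := by
  simp [wgram, Matrix.transpose_sum, Matrix.transpose_vecMulVec]

theorem dotProduct_wgram_inv_comm (c : ι → ℝ) (v : ι → Fin d → ℝ) (x y : Fin d → ℝ) :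
    x ⬝ᵥ ((wgram c v)⁻¹ *ᵥ y) = y ⬝ᵥ ((wgram c v)⁻¹ *ᵥ x) := by
  have h : ((wgram c v)⁻¹)ᵀ = (wgram c v)⁻¹ := by
    rw [Matrix.transpose_nonsing_inv, wgram_transpose]
  rw [Matrix.dotProduct_mulVec, ← Matrix.mulVec_transpose, h, dotProduct_comm]

/-- The reproducing property of weighted least squares. -/
theorem sum_mul_dotProduct_wgram_inv (h : IsUnit (wgram c v)) (x y : Fin d → ℝ) :
    ∑ i, c i * (v i ⬝ᵥ x) * (v i ⬝ᵥ ((wgram c v)⁻¹ *ᵥ y)) = x ⬝ᵥ y := by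
  have h' : IsUnit (wgram c v).det := (Matrix.isUnit_iff_isUnit_det _).1 h
  have := dotProduct_wgram_mulVec c v ((wgram c v)⁻¹ *ᵥ y) x
  rw [Matrix.mulVec_mulVec, Matrix.mul_nonsing_inv _ h', Matrix.one_mulVec] at this
  rw [this]
  exact Finset.sum_congr rfl fun i _ => by ring

theorem sum_mul_dotProduct_wgram_inv_sq (h : IsUnit (wgram c v)) (y : Fin d → ℝ) :
    ∑ i, c i * (v i ⬝ᵥ ((wgram c v)⁻¹ *ᵥ y)) ^ 2 = y ⬝ᵥ ((wgram c v)⁻¹ *ᵥ y) := by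
  rw [dotProduct_comm y, ← sum_mul_dotProduct_wgram_inv h]
  exact Finset.sum_congr rfl fun i _ => by ring

theorem dotProduct_wgram_inv_nonneg (hc : ∀ i, 0 ≤ c i) (h : IsUnit (wgram c v))
    (y : Fin d → ℝ) : 0 ≤ y ⬝ᵥ ((wgram c v)⁻¹ *ᵥ y) := by
  rw [← sum_mul_dotProduct_wgram_inv_sq h]
  exact Finset.sum_nonneg fun i _ => mul_nonneg (hc i) (sq_nonneg _)

/-- The leverages sum to the dimension. -/
theorem sum_mul_leverage (h : IsUnit (wgram c v)) :
    ∑ i, c i * (v i ⬝ᵥ ((wgram c v)⁻¹ *ᵥ v i)) = d := by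
  have h' : IsUnit (wgram c v).det := (Matrix.isUnit_iff_isUnit_det _).1 h
  have h1 : ((wgram c v)⁻¹ * wgram c v).trace = d := by
    rw [Matrix.nonsing_inv_mul _ h', Matrix.trace_one, Fintype.card_fin]
  rw [← h1]
  conv_rhs => rw [show (wgram c v)⁻¹ * wgram c v =
    (wgram c v)⁻¹ * ∑ i, c i • Matrix.vecMulVec (v i) (v i) from rfl]
  rw [Matrix.mul_sum, Matrix.trace_sum]
  refine Finset.sum_congr rfl fun i _ => ?_
  rw [Matrix.mul_smul, Matrix.trace_smul, Matrix.mul_vecMulVec, Matrix.trace_vecMulVec,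
    smul_eq_mul, dotProduct_comm]

/-- The quadratic form is `∑ c_i (v_i · x)²`, so its kernel is the common orthogonal complement of
the vectors with non-zero weight. -/
theorem isUnit_wgram_iff (hc : ∀ i, 0 ≤ c i) :
    IsUnit (wgram c v) ↔ ∀ x, (∀ i, c i ≠ 0 → v i ⬝ᵥ x = 0) → x = 0 := by
  rw [← Matrix.mulVec_injective_iff_isUnit]
  constructor
  · intro h x hx
    apply h
    rw [Matrix.mulVec_zero, wgram_mulVec]
    refine Finset.sum_eq_zero fun i _ => ?_
    by_cases hi : c i = 0
    · simp [hi]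
    · simp [hx i hi]
  · intro h x y hxy
    have h0 : wgram c v *ᵥ (x - y) = 0 := by rw [Matrix.mulVec_sub, sub_eq_zero]; exact hxy
    have h1 := dotProduct_wgram_mulVec c v (x - y) (x - y)
    rw [h0, dotProduct_zero] at h1
    have h2 := (Finset.sum_eq_zero_iff_of_nonneg (fun i _ => by
      rw [mul_assoc]; exact mul_nonneg (hc i) (mul_self_nonneg _))).1 h1.symm
    refine sub_eq_zero.1 (h _ fun i hi => ?_)
    have := h2 i (Finset.mem_univ i)
    rw [mul_assoc] at this
    simpa [hi] using this

theorem isUnit_wgram_of_le {q : ι → ℝ} {κ : ℝ} (hκ : 0 < κ) (hq : ∀ i, 0 ≤ q i)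
    (hle : ∀ i, κ * q i ≤ c i) (h : IsUnit (wgram q v)) : IsUnit (wgram c v) := by
  have hc : ∀ i, 0 ≤ c i := fun i => (mul_nonneg hκ.le (hq i)).trans (hle i)
  rw [isUnit_wgram_iff hc]
  intro x hx
  refine (isUnit_wgram_iff hq).1 h x fun i hi => hx i ?_
  have : 0 < q i := lt_of_le_of_ne (hq i) (Ne.symm hi)
  have := mul_pos hκ this
  exact (this.trans_le (hle i)).ne'

/-- Inversion reverses the Loewner order. With `x = V_c⁻¹a`, Cauchy-Schwarz in the `q`-weighted form
gives `p² ≤ (∑ q_i (v_i · x)²) r ≤ (p / κ) r`. -/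
theorem dotProduct_wgram_inv_le {q : ι → ℝ} {κ : ℝ} (hκ : 0 < κ) (hq : ∀ i, 0 ≤ q i)
    (hle : ∀ i, κ * q i ≤ c i) (h : IsUnit (wgram q v)) (a : Fin d → ℝ) :
    a ⬝ᵥ ((wgram c v)⁻¹ *ᵥ a) ≤ (a ⬝ᵥ ((wgram q v)⁻¹ *ᵥ a)) / κ := by
  have hc : ∀ i, 0 ≤ c i := fun i => (mul_nonneg hκ.le (hq i)).trans (hle i)
  have hU := isUnit_wgram_of_le hκ hq hle h
  set p := a ⬝ᵥ ((wgram c v)⁻¹ *ᵥ a) with hp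
  set r := a ⬝ᵥ ((wgram q v)⁻¹ *ᵥ a) with hr
  have hp0 : 0 ≤ p := dotProduct_wgram_inv_nonneg hc hU a
  have hr0 : 0 ≤ r := dotProduct_wgram_inv_nonneg hq h a
  set x := (wgram c v)⁻¹ *ᵥ a with hx
  have h1 : ∑ i, q i * (v i ⬝ᵥ x) * (v i ⬝ᵥ ((wgram q v)⁻¹ *ᵥ a)) = p := by
    rw [sum_mul_dotProduct_wgram_inv h, dotProduct_comm]
  have h2 : ∑ i, q i * (v i ⬝ᵥ ((wgram q v)⁻¹ *ᵥ a)) ^ 2 = r :=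
    sum_mul_dotProduct_wgram_inv_sq h a
  have h3 : κ * ∑ i, q i * (v i ⬝ᵥ x) ^ 2 ≤ p := by
    rw [hp, ← sum_mul_dotProduct_wgram_inv_sq hU, Finset.mul_sum]
    refine Finset.sum_le_sum fun i _ => ?_
    rw [← mul_assoc]
    exact mul_le_mul_of_nonneg_right (hle i) (sq_nonneg _)
  have h4 : p ^ 2 ≤ (∑ i, q i * (v i ⬝ᵥ x) ^ 2) * r := by
    rw [← h1, ← h2]
    have := Finset.sum_mul_sq_le_sq_mul_sq Finset.univ (fun i => √(q i) * (v i ⬝ᵥ x))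
      (fun i => √(q i) * (v i ⬝ᵥ ((wgram q v)⁻¹ *ᵥ a)))
    simp only [mul_pow, Real.sq_sqrt (hq _)] at this
    refine le_trans (le_of_eq ?_) this
    congr 1
    refine Finset.sum_congr rfl fun i _ => ?_
    calc _ = (√(q i) * √(q i)) * (v i ⬝ᵥ x) * (v i ⬝ᵥ ((wgram q v)⁻¹ *ᵥ a)) := by
          rw [Real.mul_self_sqrt (hq i)]
      _ = _ := by ring
  rw [le_div_iff₀ hκ]
  rcases hp0.eq_or_lt with h0 | h0
  · rw [← h0]; simpa using hr0
  · have h5 : κ * p ^ 2 ≤ p * r := by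
      calc κ * p ^ 2 ≤ κ * ((∑ i, q i * (v i ⬝ᵥ x) ^ 2) * r) := by gcongr
        _ = (κ * ∑ i, q i * (v i ⬝ᵥ x) ^ 2) * r := by ring
        _ ≤ p * r := by gcongr
    nlinarith

end WGram

/-! ### The Kiefer-Wolfowitz bound -/

theorem designMatrix_eq_wgram {d : ℕ} {𝒜 : Finset (Vec d)} (Q : 𝒜 → ℝ) :
    designMatrix Q = wgram Q (fun a : 𝒜 => (a : Vec d).ofLp) := rfl

theorem Bandit.eq_zero_of_dotProduct_eq_zero {d : ℕ} (B : Bandit d) (x : Fin d → ℝ)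
    (hx : ∀ a : B.actions, (a : Vec d).ofLp ⬝ᵥ x = 0) : x = 0 := by
  have h : ∀ y ∈ Submodule.span ℝ (B.actions : Set (Vec d)), y.ofLp ⬝ᵥ x = 0 := by
    intro y hy
    induction hy using Submodule.span_induction with
    | mem y hy => exact hx ⟨y, hy⟩
    | zero => simp
    | add y z _ _ hy hz => simp [add_dotProduct, hy, hz]
    | smul r y _ hy => simp [smul_dotProduct, hy]
  have h1 := h (WithLp.toLp 2 x) (by rw [B.span_actions]; trivial)
  exact dotProduct_self_eq_zero.1 h1

theorem Bandit.nonempty {d : ℕ} (hd : 0 < d) (B : Bandit d) : Nonempty B.actions := by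
  by_contra hne
  rw [not_nonempty_iff] at hne
  have := B.eq_zero_of_dotProduct_eq_zero (fun _ => 1) (fun a => (hne.false a).elim)
  exact one_ne_zero (congrFun this ⟨0, hd⟩)

theorem det_smul_add_smul_vecMulVec {d : ℕ} {V : Matrix (Fin d) (Fin d) ℝ} (hV : IsUnit V.det)
    (a : Fin d → ℝ) {s : ℝ} (hs : s ≠ 0) (t : ℝ) :
    (s • V + t • Matrix.vecMulVec a a).det =
      s ^ d * V.det * (1 + t / s * (a ⬝ᵥ (V⁻¹ *ᵥ a))) := by
  have hsV : IsUnit (s • V).det := by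
    rw [Matrix.det_smul, Fintype.card_fin]
    exact (IsUnit.mk0 _ (pow_ne_zero _ hs)).mul hV
  have hinv : (s • V)⁻¹ = s⁻¹ • V⁻¹ := by
    apply Matrix.inv_eq_left_inv
    rw [Matrix.smul_mul, Matrix.mul_smul, smul_smul, inv_mul_cancel₀ hs, one_smul,
      Matrix.nonsing_inv_mul _ hV]
  have := Matrix.det_add_replicateCol_mul_replicateRow (ι := Unit) hsV (t • a) a
  rw [← Matrix.vecMulVec_eq, Matrix.smul_vecMulVec] at this
  rw [this, Matrix.det_smul, Fintype.card_fin, hinv]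
  congr 1
  rw [Matrix.det_unique]
  simp only [Matrix.add_apply, Matrix.one_apply_eq, Matrix.smul_mul, Matrix.mul_smul,
    Matrix.smul_apply, smul_eq_mul]
  congr 1
  rw [Matrix.mul_assoc, Matrix.mul_apply]
  simp only [Matrix.replicateRow_apply, Matrix.mul_apply, Matrix.replicateCol_apply, dotProduct,
    Matrix.mulVec, Pi.smul_apply, smul_eq_mul]
  simp only [Finset.mul_sum]
  refine Finset.sum_congr rfl fun i _ => Finset.sum_congr rfl fun j _ => ?_
  field_simp

/-- The left side equals `1` at `t = 0`, with derivative `g - (m + 1)` there, which therefore cannot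
be positive. Bernoulli's inequality replaces the calculus. -/
theorem le_of_one_sub_pow_mul_le {m : ℕ} {g : ℝ} (hg : 0 ≤ g)
    (h : ∀ t, 0 < t → t < 1 → (1 - t) ^ m * (1 - t + t * g) ≤ 1) : g ≤ m + 1 := by
  by_contra hlt
  push Not at hlt
  have hm : (0 : ℝ) ≤ m := Nat.cast_nonneg m
  have hg1 : 1 < g := by linarith
  have hD : 0 < m * (g - 1) + g := by nlinarith
  -- After Bernoulli the product is at least `1 + t ((g - (m + 1)) - t m (g - 1))`. This `t` makes
  -- the subtracted term less than half of `g - (m + 1)`; the extra `g` in the denominator keeps it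
  -- positive for `m = 0`.
  set t := (g - (m + 1)) / (2 * (m * (g - 1) + g)) with ht
  have ht0 : 0 < t := by apply div_pos <;> linarith
  have hmul : t * (2 * (m * (g - 1) + g)) = g - (m + 1) := by
    rw [ht]; field_simp
  have ht1 : t < 1 := by
    rw [ht, div_lt_one (by linarith)]; nlinarith
  have h1 := h t ht0 ht1
  have h2 : 1 + m * (-t) ≤ (1 + -t) ^ m := one_add_mul_le_pow (by linarith) m
  have h3 : (0 : ℝ) ≤ 1 - t + t * g := by nlinarith
  have h4 : (1 + m * (-t)) * (1 - t + t * g) ≤ 1 := by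
    refine le_trans (mul_le_mul_of_nonneg_right h2 h3) ?_
    rw [← sub_eq_add_neg]; exact h1
  have h5 : t * ((g - (m + 1)) - t * (m * (g - 1))) ≤ 0 := by nlinarith
  have h6 : 0 < (g - (m + 1)) - t * (m * (g - 1)) := by nlinarith [mul_pos ht0 hD]
  nlinarith [mul_pos ht0 h6]

theorem Bandit.isUnit_designMatrix_uniform {d : ℕ} (B : Bandit d) {r : ℝ} (hr : 0 < r) :
    IsUnit (designMatrix (fun _ : B.actions => r)) := by
  rw [designMatrix_eq_wgram, isUnit_wgram_iff (fun _ => hr.le)]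
  exact fun x hx => B.eq_zero_of_dotProduct_eq_zero x fun a => hx a hr.ne'

/-- One direction of the Kiefer-Wolfowitz theorem: some design has `g(Q) ≤ d`. -/
theorem Bandit.exists_design_gValue_le {d : ℕ} (hd : 0 < d) (B : Bandit d) :
    ∃ Q : B.actions → ℝ, IsDesign Q ∧ gValue Q ≤ d := by
  classical
  have := B.nonempty hd
  -- The design is a D-optimal one. Squaring the determinant spares a discussion of its sign.
  have hcont : Continuous fun Q : B.actions → ℝ => (designMatrix Q).det ^ 2 := by
    refine Continuous.pow (Continuous.matrix_det ?_) 2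
    unfold designMatrix
    fun_prop
  obtain ⟨Q, hQ, hmax⟩ := (isCompact_stdSimplex ℝ B.actions).exists_isMaxOn
    ⟨_, single_mem_stdSimplex ℝ (Classical.arbitrary B.actions)⟩ hcont.continuousOn
  have hcard : (0 : ℝ) < Fintype.card B.actions := by exact_mod_cast Fintype.card_pos
  have hunif : (fun _ : B.actions => (Fintype.card B.actions : ℝ)⁻¹) ∈ stdSimplex ℝ B.actions :=
    ⟨fun _ => (inv_pos.2 hcard).le, by
      rw [Finset.sum_const, Finset.card_univ, nsmul_eq_mul, mul_inv_cancel₀ hcard.ne']⟩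
  have hdet : (designMatrix Q).det ≠ 0 := by
    intro h0
    have h1 := hmax hunif
    simp only [Set.mem_ofPred_eq] at h1
    rw [h0] at h1
    have h2 := (Matrix.isUnit_iff_isUnit_det _).1
      (B.isUnit_designMatrix_uniform (inv_pos.2 hcard))
    have h3 := sq_pos_of_ne_zero h2.ne_zero
    linarith
  have hU : IsUnit (designMatrix Q) := (Matrix.isUnit_iff_isUnit_det _).2 (IsUnit.mk0 _ hdet)
  refine ⟨Q, ⟨hQ.1, hQ.2, hU⟩, ciSup_le fun a => ?_⟩
  obtain ⟨m, rfl⟩ : ∃ m, d = m + 1 := ⟨d - 1, by omega⟩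
  push_cast
  have hg : 0 ≤ (a : Vec (m + 1)).ofLp ⬝ᵥ ((designMatrix Q)⁻¹ *ᵥ (a : Vec (m + 1)).ofLp) :=
    dotProduct_wgram_inv_nonneg hQ.1 hU _
  refine le_of_one_sub_pow_mul_le hg fun t ht0 ht1 => ?_
  set g := (a : Vec (m + 1)).ofLp ⬝ᵥ ((designMatrix Q)⁻¹ *ᵥ (a : Vec (m + 1)).ofLp)
  -- Moving mass `t` towards `a` multiplies the determinant by `(1 - t)^m (1 - t + t g)`, and
  -- maximality bounds this factor by `1`.
  have hmem : ((1 - t) • Q + t • Pi.single a (1 : ℝ)) ∈ stdSimplex ℝ B.actions :=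
    (convex_stdSimplex ℝ B.actions) hQ (single_mem_stdSimplex ℝ a) (by linarith) ht0.le (by ring)
  have heq : designMatrix ((1 - t) • Q + t • Pi.single a (1 : ℝ)) =
      (1 - t) • designMatrix Q +
        t • Matrix.vecMulVec (a : Vec (m + 1)).ofLp (a : Vec (m + 1)).ofLp := by
    simp only [designMatrix, Pi.add_apply, Pi.smul_apply, smul_eq_mul, add_smul,
      Finset.sum_add_distrib, mul_smul, ← Finset.smul_sum]
    congr 2
    rw [Finset.sum_eq_single a]
    · simp [outer]
    · intro b _ hb; simp [hb]
    · simp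
  have h1 := hmax hmem
  simp only [Set.mem_ofPred_eq] at h1
  rw [heq, det_smul_add_smul_vecMulVec (IsUnit.mk0 _ hdet) _ (by linarith : 1 - t ≠ 0)] at h1
  have h2 : (1 - t) ^ (m + 1) * (designMatrix Q).det * (1 + t / (1 - t) * g) =
      ((1 - t) ^ m * (1 - t + t * g)) * (designMatrix Q).det := by
    have : 1 - t ≠ 0 := by linarith
    field_simp
    ring
  rw [h2, mul_pow] at h1
  have h3 : ((1 - t) ^ m * (1 - t + t * g)) ^ 2 ≤ 1 :=
    le_of_mul_le_mul_right (by rw [one_mul]; exact h1) (sq_pos_of_ne_zero hdet)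
  exact (sq_le_one_iff_abs_le_one _).1 h3 |> fun h => (abs_le.1 h).2

theorem IsGOptimal.gValue_le {d : ℕ} (hd : 0 < d) {B : Bandit d} {Q : B.actions → ℝ}
    (hQ : IsGOptimal Q) : gValue Q ≤ d := by
  obtain ⟨Q', hQ', hle⟩ := B.exists_design_gValue_le hd
  exact (hQ.le Q' hQ').trans hle

theorem le_gValue {d : ℕ} {𝒜 : Finset (Vec d)} (Q : 𝒜 → ℝ) (a : 𝒜) :
    (a : Vec d).ofLp ⬝ᵥ ((designMatrix Q)⁻¹ *ᵥ (a : Vec d).ofLp) ≤ gValue Q :=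
  le_ciSup (f := fun a : 𝒜 => (a : Vec d).ofLp ⬝ᵥ ((designMatrix Q)⁻¹ *ᵥ (a : Vec d).ofLp))
    (Set.finite_range _).bddAbove a

/-- The leverages average to `d` under `Q`, so their maximum is at least `d`. -/
theorem IsDesign.le_gValue {d : ℕ} {𝒜 : Finset (Vec d)} {Q : 𝒜 → ℝ} (hQ : IsDesign Q) :
    (d : ℝ) ≤ gValue Q := by
  calc (d : ℝ) = ∑ a : 𝒜, Q a * ((a : Vec d).ofLp ⬝ᵥ ((designMatrix Q)⁻¹ *ᵥ (a : Vec d).ofLp)) :=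
        (sum_mul_leverage (c := Q) (v := fun a : 𝒜 => (a : Vec d).ofLp) hQ.isUnit).symm
    _ ≤ ∑ a : 𝒜, Q a * gValue Q :=
        Finset.sum_le_sum fun a _ => mul_le_mul_of_nonneg_left (MVBandit.le_gValue Q a) (hQ.nonneg a)
    _ = gValue Q := by rw [← Finset.sum_mul, hQ.sum_eq_one, one_mul]

/-! ### Moments of independent centered Gaussian variables -/

section Moments

variable {Ω : Type*} [MeasurableSpace Ω] {P : Measure Ω}

theorem integrable_sum_mul_sq {ι : Type*} [Fintype ι] {Y : ι → Ω → ℝ}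
    (hY : ∀ i, MemLp (Y i) 2 P) (c : ι → ℝ) :
    Integrable (fun x => (∑ i, c i * Y i x) ^ 2) P :=
  (memLp_finsetSum _ fun i _ => (hY i).const_mul (c i)).integrable_sq

theorem integral_sum_mul_sq [IsProbabilityMeasure P] {ι : Type*} [Fintype ι] {Y : ι → Ω → ℝ} (hY : ∀ i, MemLp (Y i) 2 P)
    (h0 : ∀ i, ∫ x, Y i x ∂P = 0) (hind : Pairwise fun i j => IndepFun (Y i) (Y j) P)
    (c : ι → ℝ) :
    ∫ x, (∑ i, c i * Y i x) ^ 2 ∂P = ∑ i, c i ^ 2 * ∫ x, Y i x ^ 2 ∂P := by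
  have hcY : ∀ i, MemLp (fun x => c i * Y i x) 2 P := fun i => (hY i).const_mul (c i)
  have h1 := IndepFun.variance_sum (μ := P) (s := Finset.univ) (X := fun i x => c i * Y i x)
    (fun i _ => hcY i) (fun i _ j _ hij =>
      (hind hij).comp (measurable_const_mul (c i)) (measurable_const_mul (c j)))
  have h2 : ∀ i, variance (fun x => c i * Y i x) P = c i ^ 2 * ∫ x, Y i x ^ 2 ∂P := by
    intro i
    rw [variance_const_mul, variance_of_integral_eq_zero (hY i).aemeasurable (h0 i)]
  have h3 : (∑ i, fun x => c i * Y i x) = fun x => ∑ i, c i * Y i x := by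
    ext x; simp
  rw [h3, variance_of_integral_eq_zero] at h1
  · rw [h1]
    exact Finset.sum_congr rfl fun i _ => h2 i
  · exact (memLp_finsetSum _ fun i _ => hcY i).aemeasurable
  · rw [integral_finsetSum _ fun i _ => (hcY i).integrable one_le_two]
    refine Finset.sum_eq_zero fun i _ => ?_
    rw [integral_const_mul, h0, mul_zero]

/-- The fourth moment of the standard Gaussian distribution. -/
def gaussianFourthMoment : ℝ := ∫ x, x ^ 4 ∂(gaussianReal 0 1)

theorem gaussianFourthMoment_nonneg : 0 ≤ gaussianFourthMoment :=
  integral_nonneg fun x => by positivity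

/-- By scaling from the standard Gaussian. The numerical value of the constant never matters. -/
theorem integral_pow_four_gaussianReal (v : NNReal) :
    ∫ x, x ^ 4 ∂(gaussianReal 0 v) = gaussianFourthMoment * (v : ℝ) ^ 2 := by
  have h := gaussianReal_map_const_mul (μ := 0) (v := 1) (√(v : ℝ))
  have hv : NNReal.mk (√(v : ℝ) ^ 2) (sq_nonneg _) * 1 = v := by
    ext; simp
  rw [mul_zero, hv] at h
  rw [← h, integral_map (by fun_prop) (by fun_prop)]
  have : ∀ x : ℝ, (√(v : ℝ) * x) ^ 4 = x ^ 4 * (v : ℝ) ^ 2 := by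
    intro x
    rw [mul_pow, show √(v : ℝ) ^ 4 = (√(v : ℝ) ^ 2) ^ 2 by ring, Real.sq_sqrt v.coe_nonneg]
    ring
  simp only [this]
  rw [integral_mul_const, gaussianFourthMoment]

variable {z : Ω → ℝ} {v : ℝ}

theorem memLp_of_map_eq_gaussianReal (hz : Measurable z)
    (hlaw : P.map z = gaussianReal 0 v.toNNReal) (p : NNReal) : MemLp z p P := by
  have h := memLp_id_gaussianReal (μ := 0) (v := v.toNNReal) p
  rw [← hlaw, memLp_map_measure_iff (by fun_prop) hz.aemeasurable] at h
  exact h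

theorem memLp_sq_of_map_eq_gaussianReal (hz : Measurable z)
    (hlaw : P.map z = gaussianReal 0 v.toNNReal) : MemLp (fun x => z x ^ 2) 2 P := by
  have h4 := (memLp_of_map_eq_gaussianReal hz hlaw 4).integrable_norm_pow (by norm_num)
  rw [memLp_two_iff_integrable_sq (by fun_prop)]
  refine h4.congr (Filter.Eventually.of_forall fun x => ?_)
  simp only [Real.norm_eq_abs]
  rw [← pow_mul, pow_abs, abs_of_nonneg]
  positivity

theorem integral_of_map_eq_gaussianReal (hz : Measurable z)
    (hlaw : P.map z = gaussianReal 0 v.toNNReal) : ∫ x, z x ∂P = 0 := by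
  have h := integral_id_gaussianReal (μ := 0) (v := v.toNNReal)
  rwa [← hlaw, integral_map hz.aemeasurable (by fun_prop)] at h

theorem integral_sq_of_map_eq_gaussianReal (hv : 0 ≤ v) (hz : Measurable z)
    (hlaw : P.map z = gaussianReal 0 v.toNNReal) : ∫ x, z x ^ 2 ∂P = v := by
  have h := variance_id_gaussianReal (μ := 0) (v := v.toNNReal)
  rw [← hlaw, variance_id_map hz.aemeasurable, variance_of_integral_eq_zero hz.aemeasurable
    (integral_of_map_eq_gaussianReal hz hlaw), Real.coe_toNNReal _ hv] at h
  exact h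

theorem integral_sq_sub_sq_le [IsProbabilityMeasure P] (hv : 0 ≤ v) (hz : Measurable z)
    (hlaw : P.map z = gaussianReal 0 v.toNNReal) :
    ∫ x, (z x ^ 2 - v) ^ 2 ∂P ≤ gaussianFourthMoment * v ^ 2 := by
  have h4 : ∫ x, z x ^ 4 ∂P = gaussianFourthMoment * v ^ 2 := by
    have h := integral_pow_four_gaussianReal v.toNNReal
    rwa [← hlaw, integral_map hz.aemeasurable (by fun_prop), Real.coe_toNNReal _ hv] at h
  have hi4 : Integrable (fun x => z x ^ 4) P := by
    have := (memLp_sq_of_map_eq_gaussianReal hz hlaw).integrable_sq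
    simpa only [← pow_mul] using this
  have hi2 : Integrable (fun x => z x ^ 2) P :=
    (memLp_sq_of_map_eq_gaussianReal hz hlaw).integrable one_le_two
  have : ∀ x, (z x ^ 2 - v) ^ 2 = z x ^ 4 - 2 * v * z x ^ 2 + v ^ 2 := fun x => by ring
  simp only [this]
  have hi3 : Integrable (fun x => z x ^ 4 - 2 * v * z x ^ 2) P := hi4.sub (hi2.const_mul _)
  rw [integral_add hi3 (integrable_const _),
    integral_sub hi4 (hi2.const_mul _), integral_const_mul,
    integral_sq_of_map_eq_gaussianReal hv hz hlaw, h4]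
  simp
  nlinarith [sq_nonneg v]

end Moments

/-- The bound for the estimation errors in terms of the hat matrix `H` of the regression, the
noise `z` and its variances `v`. -/
def errorBound {ι : Type*} [Fintype ι] (ρ : ℝ) (H : ι → ι → ℝ) (v z : ι → ℝ) : ℝ :=
  ρ * (1 + ∑ s, (∑ i, H s i * z i) ^ 2) + (1 + ∑ s, (∑ i, H s i * (z i ^ 2 - v i)) ^ 2) +
    ∑ s, (H s s * z s ^ 2 + 2 * (∑ i, H s i * z i) ^ 2)

section

variable {Ω : Type*} [MeasurableSpace Ω] {P : Measure Ω} [IsProbabilityMeasure P]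
  {ι : Type*} [Fintype ι] {z : ι → Ω → ℝ} {v : ι → ℝ} {H : ι → ι → ℝ} {ρ : ℝ}

theorem integrable_errorBound (hz : ∀ i, Measurable (z i))
    (hlaw : ∀ i, P.map (z i) = gaussianReal 0 (v i).toNNReal) :
    Integrable (fun x => errorBound ρ H v (fun i => z i x)) P := by
  have h2 : ∀ i, MemLp (z i) 2 P := fun i => memLp_of_map_eq_gaussianReal (hz i) (hlaw i) 2
  have h4 : ∀ i, MemLp (fun x => z i x ^ 2 - v i) 2 P := fun i =>
    (memLp_sq_of_map_eq_gaussianReal (hz i) (hlaw i)).sub (memLp_const _)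
  have e1 : ∀ s, Integrable (fun x => (∑ i, H s i * z i x) ^ 2) P := fun s =>
    integrable_sum_mul_sq h2 (H s)
  have e2 : ∀ s, Integrable (fun x => (∑ i, H s i * (z i x ^ 2 - v i)) ^ 2) P := fun s =>
    integrable_sum_mul_sq h4 (H s)
  unfold errorBound
  refine Integrable.add (Integrable.add (Integrable.const_mul
    ((integrable_const _).add (integrable_finsetSum _ fun s _ => e1 s)) _)
    ((integrable_const _).add (integrable_finsetSum _ fun s _ => e2 s)))
    (integrable_finsetSum _ fun s _ => ?_)
  exact ((h2 s).integrable_sq.const_mul _).add ((e1 s).const_mul _)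

/-- By independence `E (Hy)_s² = ∑_i H_si² E y_i²`, and `∑_i H_si² = H_ss`; summing over `s` leaves
the trace `D`. This is applied to `y = z` and to `y = z² - v`. -/
theorem integral_errorBound_le (hρ : 0 ≤ ρ) (hz : ∀ i, Measurable (z i))
    (hlaw : ∀ i, P.map (z i) = gaussianReal 0 (v i).toNNReal) (hind : iIndepFun z P)
    (hv : ∀ i, 0 ≤ v i) {w : ℝ} (hw : ∀ i, v i ≤ w) (hH : ∀ s, ∑ i, H s i ^ 2 = H s s)
    {D : ℝ} (hD : ∑ s, H s s = D) :
    ∫ x, errorBound ρ H v (fun i => z i x) ∂P ≤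
      ρ * (1 + D * w) + (1 + D * (gaussianFourthMoment * w ^ 2)) + 3 * (D * w) := by
  have h2 : ∀ i, MemLp (z i) 2 P := fun i => memLp_of_map_eq_gaussianReal (hz i) (hlaw i) 2
  have h4 : ∀ i, MemLp (fun x => z i x ^ 2 - v i) 2 P := fun i =>
    (memLp_sq_of_map_eq_gaussianReal (hz i) (hlaw i)).sub (memLp_const _)
  have e1 : ∀ s, Integrable (fun x => (∑ i, H s i * z i x) ^ 2) P := fun s =>
    integrable_sum_mul_sq h2 (H s)
  have e2 : ∀ s, Integrable (fun x => (∑ i, H s i * (z i x ^ 2 - v i)) ^ 2) P := fun s =>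
    integrable_sum_mul_sq h4 (H s)
  have e3 : ∀ s, Integrable (fun x => H s s * z s x ^ 2 + 2 * (∑ i, H s i * z i x) ^ 2) P :=
    fun s => ((h2 s).integrable_sq.const_mul _).add ((e1 s).const_mul _)
  have s1 : Integrable (fun x => ∑ s, (∑ i, H s i * z i x) ^ 2) P :=
    integrable_finsetSum _ fun s _ => e1 s
  have s2 : Integrable (fun x => ∑ s, (∑ i, H s i * (z i x ^ 2 - v i)) ^ 2) P :=
    integrable_finsetSum _ fun s _ => e2 s
  have s3 : Integrable
      (fun x => ∑ s, (H s s * z s x ^ 2 + 2 * (∑ i, H s i * z i x) ^ 2)) P :=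
    integrable_finsetSum _ fun s _ => e3 s
  have hHs : ∀ s, 0 ≤ H s s := fun s => by
    rw [← hH]; exact Finset.sum_nonneg fun i _ => sq_nonneg _
  have b1 : ∀ s, ∫ x, (∑ i, H s i * z i x) ^ 2 ∂P ≤ H s s * w := by
    intro s
    rw [integral_sum_mul_sq h2 (fun i => integral_of_map_eq_gaussianReal (hz i) (hlaw i))
      (fun i j hij => hind.indepFun hij), ← hH, Finset.sum_mul]
    refine Finset.sum_le_sum fun i _ => mul_le_mul_of_nonneg_left ?_ (sq_nonneg _)
    rw [integral_sq_of_map_eq_gaussianReal (hv i) (hz i) (hlaw i)]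
    exact hw i
  have b2 : ∀ s, ∫ x, (∑ i, H s i * (z i x ^ 2 - v i)) ^ 2 ∂P ≤
      H s s * (gaussianFourthMoment * w ^ 2) := by
    intro s
    rw [integral_sum_mul_sq (Y := fun i x => z i x ^ 2 - v i) h4 ?_ ?_, ← hH, Finset.sum_mul]
    · refine Finset.sum_le_sum fun i _ => mul_le_mul_of_nonneg_left ?_ (sq_nonneg _)
      refine (integral_sq_sub_sq_le (hv i) (hz i) (hlaw i)).trans ?_
      have := gaussianFourthMoment_nonneg
      have := hv i
      have := hw i
      gcongr
    · intro i
      rw [integral_sub (h2 i).integrable_sq (integrable_const _),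
        integral_sq_of_map_eq_gaussianReal (hv i) (hz i) (hlaw i)]
      simp
    · intro i j hij
      exact (hind.indepFun hij).comp (φ := fun y => y ^ 2 - v i) (ψ := fun y => y ^ 2 - v j)
        (by fun_prop) (by fun_prop)
  have b3 : ∀ s, ∫ x, (H s s * z s x ^ 2 + 2 * (∑ i, H s i * z i x) ^ 2) ∂P ≤
      3 * (H s s * w) := by
    intro s
    rw [integral_add ((h2 s).integrable_sq.const_mul _) ((e1 s).const_mul _), integral_const_mul,
      integral_const_mul, integral_sq_of_map_eq_gaussianReal (hv s) (hz s) (hlaw s)]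
    have := mul_le_mul_of_nonneg_left (hw s) (hHs s)
    linarith [b1 s]
  have s4 : Integrable (fun x => ρ * (1 + ∑ s, (∑ i, H s i * z i x) ^ 2)) P :=
    ((integrable_const _).add s1).const_mul _
  have s5 : Integrable (fun x => 1 + ∑ s, (∑ i, H s i * (z i x ^ 2 - v i)) ^ 2) P :=
    (integrable_const _).add s2
  have s6 : Integrable (fun x => ρ * (1 + ∑ s, (∑ i, H s i * z i x) ^ 2) +
      (1 + ∑ s, (∑ i, H s i * (z i x ^ 2 - v i)) ^ 2)) P := s4.add s5
  simp only [errorBound]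
  rw [integral_add s6 s3, integral_add s4 s5,
    integral_const_mul, integral_add (integrable_const _) s1, integral_add (integrable_const _) s2,
    integral_finsetSum _ fun s _ => e1 s, integral_finsetSum _ fun s _ => e2 s,
    integral_finsetSum _ fun s _ => e3 s]
  simp only [integral_const, probReal_univ, one_smul]
  rw [← hD, Finset.sum_mul, Finset.sum_mul, Finset.mul_sum Finset.univ _ (3 : ℝ)]
  have t1 := Finset.sum_le_sum fun s (_ : s ∈ Finset.univ) => b1 s
  have t2 := Finset.sum_le_sum fun s (_ : s ∈ Finset.univ) => b2 s
  have t3 := Finset.sum_le_sum fun s (_ : s ∈ Finset.univ) => b3 s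
  have := mul_le_mul_of_nonneg_left t1 hρ
  linarith

end

/-! ### The hat matrix -/

/-- The entry `v_sᵀ V⁻¹ v_i` of the hat matrix, where `V = ∑_i v_i v_iᵀ`. -/
def hat {ι : Type*} [Fintype ι] {d : ℕ} (v : ι → Fin d → ℝ) (s i : ι) : ℝ :=
  v s ⬝ᵥ ((wgram 1 v)⁻¹ *ᵥ v i)

section Hat

variable {ι : Type*} [Fintype ι] {d : ℕ} {v : ι → Fin d → ℝ}

theorem hat_comm (s i : ι) : hat v s i = hat v i s := dotProduct_wgram_inv_comm _ _ _ _

theorem sum_hat_sq (h : IsUnit (wgram 1 v)) (s : ι) : ∑ i, hat v s i ^ 2 = hat v s s := by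
  have := sum_mul_dotProduct_wgram_inv_sq h (v s)
  simp only [Pi.one_apply, one_mul] at this
  rw [hat, ← this]
  exact Finset.sum_congr rfl fun i _ => by rw [hat_comm]; rfl

theorem sum_hat_diag (h : IsUnit (wgram 1 v)) : ∑ s, hat v s s = d := by
  have := sum_mul_leverage h
  simp only [Pi.one_apply, one_mul] at this
  exact this

theorem hat_diag_nonneg (h : IsUnit (wgram 1 v)) (s : ι) : 0 ≤ hat v s s := by
  rw [← sum_hat_sq h]
  exact Finset.sum_nonneg fun i _ => sq_nonneg _

theorem hat_diag_le_one (h : IsUnit (wgram 1 v)) (s : ι) : hat v s s ≤ 1 := by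
  have h1 : hat v s s ^ 2 ≤ hat v s s := by
    conv_rhs => rw [← sum_hat_sq h]
    exact Finset.single_le_sum (f := fun i => hat v s i ^ 2) (fun i _ => sq_nonneg _)
      (Finset.mem_univ s)
  by_contra! hlt
  nlinarith

/-- The weights `s ↦ v_s · V⁻¹u` lie in the range of the hat projection. -/
theorem dotProduct_wgram_inv_eq_sum_hat (h : IsUnit (wgram 1 v)) (u : Fin d → ℝ) (s : ι) :
    v s ⬝ᵥ ((wgram 1 v)⁻¹ *ᵥ u) = ∑ i, hat v i s * (v i ⬝ᵥ ((wgram 1 v)⁻¹ *ᵥ u)) := by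
  have := sum_mul_dotProduct_wgram_inv h ((wgram 1 v)⁻¹ *ᵥ v s) u
  simp only [Pi.one_apply, one_mul] at this
  rw [dotProduct_wgram_inv_comm, dotProduct_comm, ← this]
  rfl

theorem sum_sq_dotProduct (h : IsUnit (wgram 1 v)) (u : Fin d → ℝ) :
    ∑ i, (v i ⬝ᵥ ((wgram 1 v)⁻¹ *ᵥ u)) ^ 2 = u ⬝ᵥ ((wgram 1 v)⁻¹ *ᵥ u) := by
  simpa only [Pi.one_apply, one_mul] using sum_mul_dotProduct_wgram_inv_sq h u

theorem abs_dotProduct_wgram_inv_le (h : IsUnit (wgram 1 v)) {u : Fin d → ℝ} {M : ℝ} (hM : 0 ≤ M)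
    (hu : u ⬝ᵥ ((wgram 1 v)⁻¹ *ᵥ u) ≤ M ^ 2) (s : ι) :
    |v s ⬝ᵥ ((wgram 1 v)⁻¹ *ᵥ u)| ≤ M * √(hat v s s) := by
  have hH := hat_diag_nonneg h s
  refine abs_le_of_sq_le_sq ?_ (mul_nonneg hM (Real.sqrt_nonneg _))
  rw [mul_pow, Real.sq_sqrt hH, dotProduct_wgram_inv_eq_sum_hat h]
  refine (Finset.sum_mul_sq_le_sq_mul_sq _ _ _).trans ?_
  rw [sum_sq_dotProduct h, Finset.sum_congr rfl fun i _ => by rw [hat_comm], sum_hat_sq h, mul_comm]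
  gcongr

theorem abs_sum_mul_dotProduct_wgram_inv_le (h : IsUnit (wgram 1 v)) {u : Fin d → ℝ} {M : ℝ}
    (hM : 0 ≤ M) (hu : u ⬝ᵥ ((wgram 1 v)⁻¹ *ᵥ u) ≤ M ^ 2) (y : ι → ℝ) :
    |∑ s, y s * (v s ⬝ᵥ ((wgram 1 v)⁻¹ *ᵥ u))| ≤ M * (1 + ∑ s, (∑ i, hat v s i * y i) ^ 2) := by
  set S := ∑ s, (∑ i, hat v s i * y i) ^ 2 with hS
  have hS0 : 0 ≤ S := Finset.sum_nonneg fun s _ => sq_nonneg _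
  have heq : ∑ s, y s * (v s ⬝ᵥ ((wgram 1 v)⁻¹ *ᵥ u)) =
      ∑ s, (∑ i, hat v s i * y i) * (v s ⬝ᵥ ((wgram 1 v)⁻¹ *ᵥ u)) := by
    simp_rw [Finset.sum_mul]
    rw [Finset.sum_comm]
    refine Finset.sum_congr rfl fun s _ => ?_
    rw [dotProduct_wgram_inv_eq_sum_hat h, Finset.mul_sum]
    exact Finset.sum_congr rfl fun i _ => by ring
  refine abs_le_of_sq_le_sq ?_ (mul_nonneg hM (by linarith))
  rw [heq]
  refine (Finset.sum_mul_sq_le_sq_mul_sq _ _ _).trans ?_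
  rw [sum_sq_dotProduct h, mul_pow, mul_comm]
  -- Here `S ≤ (1 + S)²`. Using `1 + S` in place of `√S` keeps the bound quadratic in `y`; the
  -- resulting order `d` is no worse than that of the residual terms of `errorBound`.
  exact mul_le_mul hu (by nlinarith) hS0 (sq_nonneg _)

end Hat

/-! ### The estimation error -/

section Estimation

variable {d n : ℕ} {𝒜 : Finset (Vec d)}

/-- The actions occurring in the data. -/
def points (h : Fin n → 𝒜 × ℝ) (s : Fin n) : Fin d → ℝ := ((h s).1 : Vec d).ofLp

theorem gram_eq_wgram (h : Fin n → 𝒜 × ℝ) : gram h = wgram 1 (points h) := by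
  simp only [gram, wgram, Pi.one_apply, one_smul]
  rfl

theorem inner_eq_dotProduct (x y : Vec d) : ⟪x, y⟫ = x.ofLp ⬝ᵥ y.ofLp := by
  rw [EuclideanSpace.inner_eq_star_dotProduct, star_trivial, dotProduct_comm]

theorem inner_leastSquares (h : Fin n → 𝒜 × ℝ) (y : Fin n → ℝ) (u : Vec d) :
    ⟪leastSquares h y, u⟫ =
      ∑ s, y s * (points h s ⬝ᵥ ((wgram 1 (points h))⁻¹ *ᵥ u.ofLp)) := by
  rw [inner_eq_dotProduct, leastSquares, dotProduct_comm, gram_eq_wgram, dotProduct_wgram_inv_comm,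
    WithLp.ofLp_sum, sum_dotProduct]
  refine Finset.sum_congr rfl fun s _ => ?_
  rw [WithLp.ofLp_smul, smul_dotProduct, smul_eq_mul, points]

/-- Least squares reproduces `ψ` from its own noiseless responses, so only the deviations from them
remain. -/
theorem inner_leastSquares_sub {h : Fin n → 𝒜 × ℝ} (hV : IsUnit (wgram 1 (points h)))
    (y : Fin n → ℝ) (ψ u : Vec d) :
    ⟪leastSquares h y - ψ, u⟫ = ∑ s, (y s - ⟪ψ, ((h s).1 : Vec d)⟫) *
      (points h s ⬝ᵥ ((wgram 1 (points h))⁻¹ *ᵥ u.ofLp)) := by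
  have := sum_mul_dotProduct_wgram_inv hV ψ.ofLp u.ofLp
  simp only [Pi.one_apply, one_mul] at this
  simp only [sub_mul, Finset.sum_sub_distrib, inner_sub_left, inner_leastSquares]
  rw [inner_eq_dotProduct ψ, ← this]
  congr 1

theorem inner_thetaHat_sub {B : Bandit d} {h : Fin n → B.actions × ℝ} {z : Fin n → ℝ}
    (hV : IsUnit (wgram 1 (points h))) (hz : ∀ s, (h s).2 = B.mean (h s).1 + z s) (u : Vec d) :
    ⟪thetaHat h - B.θ, u⟫ =
      ∑ s, z s * (points h s ⬝ᵥ ((wgram 1 (points h))⁻¹ *ᵥ u.ofLp)) := by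
  rw [thetaHat, inner_leastSquares_sub hV]
  refine Finset.sum_congr rfl fun s _ => ?_
  rw [hz, Bandit.mean, real_inner_comm, add_sub_cancel_left]

/-- The residual of round `s` is `z_s - (Hz)_s`. Its square splits into `z_s²`, centered by the
variance, and the effect of plugging in `θ̂`. -/
theorem inner_phiHat_sub {B : Bandit d} {h : Fin n → B.actions × ℝ} {z : Fin n → ℝ}
    (hV : IsUnit (wgram 1 (points h))) (hz : ∀ s, (h s).2 = B.mean (h s).1 + z s) (u : Vec d) :
    ⟪phiHat B.ω h - B.φ, u⟫ =
      ∑ s, (z s ^ 2 - B.var (h s).1) * (points h s ⬝ᵥ ((wgram 1 (points h))⁻¹ *ᵥ u.ofLp)) +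
      ∑ s, ((∑ i, hat (points h) s i * z i) ^ 2 - 2 * z s * ∑ i, hat (points h) s i * z i) *
        (points h s ⬝ᵥ ((wgram 1 (points h))⁻¹ *ᵥ u.ofLp)) := by
  rw [phiHat, inner_leastSquares_sub hV, ← Finset.sum_add_distrib]
  refine Finset.sum_congr rfl fun s _ => ?_
  rw [← add_mul]
  congr 1
  have h1 : ⟪thetaHat h, ((h s).1 : Vec d)⟫ = B.mean (h s).1 + ∑ i, hat (points h) s i * z i := by
    have := inner_thetaHat_sub hV hz ((h s).1 : Vec d)
    rw [inner_sub_left, sub_eq_iff_eq_add'] at this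
    rw [this, Bandit.mean, real_inner_comm]
    congr 1
    refine Finset.sum_congr rfl fun i _ => ?_
    rw [hat_comm, mul_comm]
    rfl
  rw [h1, hz, varFunInv, Bandit.var, varFun]
  ring

theorem abs_estimation_error_le {B : Bandit d} {h : Fin n → B.actions × ℝ} {z : Fin n → ℝ}
    {ρ : ℝ} (hρ : 0 ≤ ρ) (hV : IsUnit (wgram 1 (points h)))
    (hz : ∀ s, (h s).2 = B.mean (h s).1 + z s) {u : Vec d} {M : ℝ} (hM : 0 ≤ M)
    (hu : u.ofLp ⬝ᵥ ((wgram 1 (points h))⁻¹ *ᵥ u.ofLp) ≤ M ^ 2) :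
    |⟪phiHat B.ω h - ρ • thetaHat h, u⟫ - ⟪B.φ - ρ • B.θ, u⟫| ≤
      M * errorBound ρ (hat (points h)) (fun s => B.var (h s).1) z := by
  have hθ : |⟪thetaHat h - B.θ, u⟫| ≤
      M * (1 + ∑ s, (∑ i, hat (points h) s i * z i) ^ 2) := by
    rw [inner_thetaHat_sub hV hz]
    exact abs_sum_mul_dotProduct_wgram_inv_le hV hM hu z
  have hφ₁ := abs_sum_mul_dotProduct_wgram_inv_le hV hM hu (fun s => z s ^ 2 - B.var (h s).1)
  have hφ₂ : |∑ s, ((∑ i, hat (points h) s i * z i) ^ 2 -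
      2 * z s * ∑ i, hat (points h) s i * z i) *
        (points h s ⬝ᵥ ((wgram 1 (points h))⁻¹ *ᵥ u.ofLp))| ≤
      M * ∑ s, (hat (points h) s s * z s ^ 2 + 2 * (∑ i, hat (points h) s i * z i) ^ 2) := by
    rw [Finset.mul_sum]
    refine (Finset.abs_sum_le_sum_abs _ _).trans (Finset.sum_le_sum fun s _ => ?_)
    set e := ∑ i, hat (points h) s i * z i
    have hH0 := hat_diag_nonneg hV s
    have hH1 := hat_diag_le_one hV s
    have hw := abs_dotProduct_wgram_inv_le hV hM hu s
    set r := √(hat (points h) s s)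
    have hr0 : 0 ≤ r := Real.sqrt_nonneg _
    have hr1 : r ≤ 1 := Real.sqrt_le_one.2 hH1
    have hrr : r ^ 2 = hat (points h) s s := Real.sq_sqrt hH0
    rw [abs_mul]
    -- The factor `r = √H_ss` goes to `z_s` in the arithmetic-geometric mean inequality. It turns `∑
    -- z_s²`, of order `n`, into `∑ H_ss z_s²`, of order `d`.
    have h1 : |e ^ 2 - 2 * z s * e| * r ≤ hat (points h) s s * z s ^ 2 + 2 * e ^ 2 := by
      have h2 : |e ^ 2 - 2 * z s * e| ≤ e ^ 2 + 2 * |z s| * |e| := by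
        refine (abs_sub _ _).trans ?_
        rw [abs_mul, abs_mul, abs_two, abs_of_nonneg (sq_nonneg e)]
      calc |e ^ 2 - 2 * z s * e| * r ≤ (e ^ 2 + 2 * |z s| * |e|) * r := by gcongr
        _ = e ^ 2 * r + 2 * (r * |z s|) * |e| := by ring
        _ ≤ e ^ 2 * 1 + ((r * |z s|) ^ 2 + |e| ^ 2) := by
            gcongr
            exact two_mul_le_add_sq _ _
        _ = _ := by rw [mul_pow, sq_abs, sq_abs, hrr]; ring
    calc _ ≤ |e ^ 2 - 2 * z s * e| * (M * r) := by gcongr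
      _ = M * (|e ^ 2 - 2 * z s * e| * r) := by ring
      _ ≤ _ := by gcongr
  have heq : ⟪phiHat B.ω h - ρ • thetaHat h, u⟫ - ⟪B.φ - ρ • B.θ, u⟫ =
      ⟪phiHat B.ω h - B.φ, u⟫ - ρ * ⟪thetaHat h - B.θ, u⟫ := by
    simp only [inner_sub_left, real_inner_smul_left]
    ring
  rw [heq, inner_phiHat_sub hV hz]
  refine (abs_sub _ _).trans ?_
  rw [abs_mul, abs_of_nonneg hρ]
  have := mul_le_mul_of_nonneg_left hθ hρ
  refine (add_le_add (abs_add_le _ _) le_rfl).trans ?_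
  unfold errorBound
  linarith

/-- The estimated order favors the selected action, so its true gap is at most the sum of the two
estimation errors. The bound is uniform over actions, so it applies although the selection depends
on the data. -/
theorem mvDiff_sel_le {B : Bandit d} {h : Fin n → B.actions × ℝ} {z : Fin n → ℝ}
    {ρ : ℝ} (hρ : 0 ≤ ρ) (hV : IsUnit (wgram 1 (points h)))
    (hz : ∀ s, (h s).2 = B.mean (h s).1 + z s) {M : ℝ} (hM : 0 ≤ M)
    (hu : ∀ a : B.actions, (a : Vec d).ofLp ⬝ᵥ ((wgram 1 (points h))⁻¹ *ᵥ (a : Vec d).ofLp) ≤ M ^ 2)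
    {sel : (B.actions → ℝ) → B.actions} (hsel : IsArgmin sel) (b : B.actions) :
    B.mvDiff ρ (sel fun a => ⟪phiHat B.ω h - ρ • thetaHat h, (a : Vec d)⟫) b ≤
      2 * M * errorBound ρ (hat (points h)) (fun s => B.var (h s).1) z := by
  have hmv : ∀ a, B.mv ρ a = ⟪B.φ - ρ • B.θ, (a : Vec d)⟫ + B.ω := by
    intro a
    rw [Bandit.mv, Bandit.var, varFun, Bandit.mean, inner_sub_left, real_inner_smul_left,
      real_inner_comm B.θ]
    ring
  have hle := hsel.le (fun a => ⟪phiHat B.ω h - ρ • thetaHat h, (a : Vec d)⟫) b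
  set â := sel fun a => ⟪phiHat B.ω h - ρ • thetaHat h, (a : Vec d)⟫
  have h1 := abs_le.1 (abs_estimation_error_le hρ hV hz hM (hu â))
  have h2 := abs_le.1 (abs_estimation_error_le hρ hV hz hM (hu b))
  rw [Bandit.mvDiff, hmv, hmv]
  linarith [h1.1, h2.2]

end Estimation

/-! ### The exploration phase -/

/-- The factor `N` such that `n_a = ⌈N g(Q) Q(a)⌉`. -/
def exploreScale (d : ℕ) (C δ ε : ℝ) : ℝ :=
  C ^ 2 * (d : ℝ) ^ 2 * Real.log d * Real.log δ⁻¹ ^ 2 / ε ^ 2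

section Exploration

variable {d : ℕ} {𝒜 : Finset (Vec d)} {C δ ε : ℝ} {Q : 𝒜 → ℝ}

theorem exploreCount_eq (C δ ε : ℝ) (Q : 𝒜 → ℝ) (a : 𝒜) :
    exploreCount C δ ε Q a = ⌈exploreScale d C δ ε * gValue Q * Q a⌉₊ := by
  rw [exploreCount, exploreScale]
  congr 1
  ring

/-- Rounding up costs at most one round per support point and nothing elsewhere, and the support has
at most `d(d+1)/2 ≤ d²` points. -/
theorem exploreLength_le (hN : 0 ≤ exploreScale d C δ ε) (hQ : IsGOptimal Q) :
    (exploreLength C δ ε Q : ℝ) ≤ exploreScale d C δ ε * gValue Q + (d : ℝ) ^ 2 := by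
  classical
  have hg : 0 ≤ gValue Q := d.cast_nonneg.trans hQ.isDesign.le_gValue
  have h1 : ∀ a, (exploreCount C δ ε Q a : ℝ) ≤
      exploreScale d C δ ε * gValue Q * Q a + if Q a ≠ 0 then 1 else 0 := by
    intro a
    rw [exploreCount_eq]
    split_ifs with h
    · exact (Nat.ceil_lt_add_one (mul_nonneg (mul_nonneg hN hg) (hQ.isDesign.nonneg a))).le
    · simp [not_not.1 h]
  have h2 : ∑ a, (if Q a ≠ 0 then (1 : ℝ) else 0) = ((Function.support Q).ncard : ℝ) := by
    rw [Finset.sum_boole, Set.ncard_eq_toFinset_card']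
    congr 2
    ext a
    simp
  have h3 : (Function.support Q).ncard ≤ d ^ 2 := by
    refine hQ.card_support_le.trans ?_
    rcases Nat.eq_zero_or_pos d with rfl | hd
    · simp
    · exact Nat.div_le_of_le_mul (by nlinarith)
  have h4 : ((Function.support Q).ncard : ℝ) ≤ (d : ℝ) ^ 2 := by exact_mod_cast h3
  rw [exploreLength, Nat.cast_sum]
  refine (Finset.sum_le_sum fun a _ => h1 a).trans ?_
  rw [Finset.sum_add_distrib, ← Finset.mul_sum, hQ.isDesign.sum_eq_one, h2, mul_one]
  linarith

variable {e : ℕ → 𝒜}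

theorem IsExploreOrder.wgram_eq (he : IsExploreOrder C δ ε Q e)
    {h : Fin (exploreLength C δ ε Q) → 𝒜 × ℝ} (hh : ∀ s, (h s).1 = e s) :
    wgram 1 (points h) =
      wgram (fun a => (exploreCount C δ ε Q a : ℝ)) fun a : 𝒜 => (a : Vec d).ofLp := by
  classical
  have h1 : wgram 1 (points h) = ∑ s ∈ Finset.range (exploreLength C δ ε Q),
      Matrix.vecMulVec (e s : Vec d).ofLp (e s : Vec d).ofLp := by
    rw [← Fin.sum_univ_eq_sum_range
      (fun s => Matrix.vecMulVec (e s : Vec d).ofLp (e s : Vec d).ofLp)]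
    simp only [wgram, Pi.one_apply, one_smul, points, hh]
  rw [h1, wgram, ← Finset.sum_fiberwise (Finset.range (exploreLength C δ ε Q)) e]
  refine Finset.sum_congr rfl fun a _ => ?_
  rw [← he a, Finset.sum_congr rfl (g := fun _ =>
    Matrix.vecMulVec (a : Vec d).ofLp (a : Vec d).ofLp)]
  · rw [Finset.sum_const, ← Nat.cast_smul_eq_nsmul ℝ]
  · intro s hs
    rw [(Finset.mem_filter.1 hs).2]

theorem le_exploreCount (a : 𝒜) :
    exploreScale d C δ ε * gValue Q * Q a ≤ (exploreCount C δ ε Q a : ℝ) := by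
  rw [exploreCount_eq]
  exact Nat.le_ceil _

theorem IsExploreOrder.isUnit_wgram (he : IsExploreOrder C δ ε Q e) (hd : 0 < d)
    (hN : 0 < exploreScale d C δ ε) (hQ : IsDesign Q)
    {h : Fin (exploreLength C δ ε Q) → 𝒜 × ℝ} (hh : ∀ s, (h s).1 = e s) :
    IsUnit (wgram 1 (points h)) := by
  have hg : 0 < gValue Q := (Nat.cast_pos.2 hd).trans_le hQ.le_gValue
  rw [he.wgram_eq hh]
  exact isUnit_wgram_of_le (mul_pos hN hg) hQ.nonneg le_exploreCount hQ.isUnit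

/-- The counts dominate `N g(Q) Q(a)`, so the leverage is at most `g(Q) / (N g(Q))`. -/
theorem IsExploreOrder.leverage_le (he : IsExploreOrder C δ ε Q e) (hd : 0 < d)
    (hN : 0 < exploreScale d C δ ε) (hQ : IsDesign Q)
    {h : Fin (exploreLength C δ ε Q) → 𝒜 × ℝ} (hh : ∀ s, (h s).1 = e s) (a : 𝒜) :
    (a : Vec d).ofLp ⬝ᵥ ((wgram 1 (points h))⁻¹ *ᵥ (a : Vec d).ofLp) ≤
      (exploreScale d C δ ε)⁻¹ := by
  have hg : 0 < gValue Q := (Nat.cast_pos.2 hd).trans_le hQ.le_gValue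
  rw [he.wgram_eq hh]
  refine (dotProduct_wgram_inv_le (mul_pos hN hg) hQ.nonneg le_exploreCount hQ.isUnit _).trans ?_
  rw [div_le_iff₀ (mul_pos hN hg), inv_mul_cancel_left₀ hN.ne']
  exact MVBandit.le_gValue Q a

end Exploration

/-! ### Decomposition of the regret -/

section Regret

variable {d : ℕ} {B : Bandit d}

/-- Consequently `toNNReal` in the law of the noise truncates nothing. -/
theorem Bandit.var_nonneg (B : Bandit d) (a : B.actions) : 0 ≤ B.var a := by
  have h1 := abs_le.1 ((abs_real_inner_le_norm B.φ (a : Vec d)).trans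
    (mul_le_mul B.norm_φ_le (B.norm_action_le a a.2) (norm_nonneg _)
      ((norm_nonneg _).trans B.norm_φ_le)))
  rw [Bandit.var, varFun]
  linarith [h1.1]

theorem Bandit.abs_mean_le (B : Bandit d) (a : B.actions) : |B.mean a| ≤ 1 := by
  refine (abs_real_inner_le_norm _ _).trans ?_
  exact mul_le_one₀ (B.norm_action_le a a.2) (norm_nonneg _) B.norm_θ_le

theorem Bandit.meanDiff_sq_le (B : Bandit d) (a b : B.actions) : B.meanDiff a b ^ 2 ≤ 4 := by
  have h1 := abs_le.1 (B.abs_mean_le a)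
  have h2 := abs_le.1 (B.abs_mean_le b)
  rw [Bandit.meanDiff]
  nlinarith [h1.1, h1.2, h2.1, h2.2]

theorem Bandit.mvDiff_le {ρ w : ℝ} (hρ : 0 ≤ ρ) (hw : ∀ a, B.var a ≤ w) (a b : B.actions) :
    B.mvDiff ρ a b ≤ w + 2 * ρ := by
  have h1 := abs_le.1 (B.abs_mean_le a)
  have h2 := abs_le.1 (B.abs_mean_le b)
  rw [Bandit.mvDiff, Bandit.mv, Bandit.mv]
  nlinarith [hw a, B.var_nonneg b, mul_le_mul_of_nonneg_left h1.1 hρ,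
    mul_le_mul_of_nonneg_left h2.2 hρ]

variable {Ω : Type*}

theorem sum_pulls_mul {α : Type*} [Fintype α] (A : ℕ → Ω → α) (T : ℕ) (F : α → ℝ) (x : Ω) :
    ∑ a, pulls A T a x * F a = ∑ t ∈ Finset.range T, F (A t x) := by
  classical
  simp only [pulls, Finset.sum_mul]
  rw [Finset.sum_comm]
  refine Finset.sum_congr rfl fun t _ => ?_
  simp

theorem integrable_mul_pulls {α : Type*} [MeasurableSpace α] [MeasurableSingletonClass α]
    [MeasurableSpace Ω] {P : Measure Ω} {A : ℕ → Ω → α} (hA : ∀ t, Measurable (A t)) (T : ℕ)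
    (a : α) {f : Ω → ℝ} (hf : Integrable f P) : Integrable (fun x => f x * pulls A T a x) P := by
  classical
  simp only [pulls, Finset.mul_sum]
  refine integrable_finsetSum _ fun t _ => ?_
  refine (hf.indicator (hA t (measurableSet_singleton a))).congr
    (Filter.Eventually.of_forall fun x => ?_)
  simp only [Set.indicator_apply, Set.mem_preimage, Set.mem_singleton_iff]
  split_ifs <;> simp

/-- The regret is at most a multiple of the number `m` of initial rounds, plus `T` times a bound
for the gap of the action that is played in all later rounds. -/
theorem Bandit.intermediateRegret_le [MeasurableSpace Ω] {P : Measure Ω} [IsProbabilityMeasure P]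
    {ρ w : ℝ} (hρ : 0 ≤ ρ) (hw : ∀ a, B.var a ≤ w) (aStar : B.actions)
    {A : ℕ → Ω → B.actions} (hA : ∀ t, Measurable (A t)) {T : ℕ} (hT : 0 < T) (m : ℕ)
    {D : Ω → ℝ} (hD : Integrable D P) (hD0 : ∀ x, 0 ≤ D x)
    (hgap : ∀ t x, m ≤ t → t < T → B.mvDiff ρ (A t x) aStar ≤ D x)
    (hconst : ∀ s t x, m ≤ s → s < T → m ≤ t → t < T → A s x = A t x) :
    B.intermediateRegret P ρ aStar A T ≤ (w + 2 * ρ + 8) * m + T * ∫ x, D x ∂P := by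
  classical
  have hT' : (0 : ℝ) < T := Nat.cast_pos.2 hT
  have hK : 0 ≤ w + 2 * ρ := by linarith [(B.var_nonneg aStar).trans (hw aStar)]
  have i1 : ∀ a, Integrable (pulls A T a) P := fun a => by
    simpa only [one_mul] using integrable_mul_pulls hA T a (integrable_const (μ := P) (1 : ℝ))
  have i2 : ∀ a b, Integrable (fun x => pulls A T a x * pulls A T b x) P := fun a b =>
    integrable_mul_pulls hA T b (i1 a)
  have i3 : Integrable (fun x => ∑ a, pulls A T a x * B.mvDiff ρ a aStar) P :=
    integrable_finsetSum _ fun a _ => (i1 a).mul_const _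
  have i4 : Integrable (fun x => ∑ a, ∑ b ∈ Finset.univ.filter (fun b => b ≠ a),
      pulls A T a x * pulls A T b x * B.meanDiff a b ^ 2) P :=
    integrable_finsetSum _ fun a _ => integrable_finsetSum _ fun b _ => (i2 a b).mul_const _
  have hR : B.intermediateRegret P ρ aStar A T =
      ∫ x, (∑ a, pulls A T a x * B.mvDiff ρ a aStar +
        (1 / (T : ℝ)) * ∑ a, ∑ b ∈ Finset.univ.filter (fun b => b ≠ a),
          pulls A T a x * pulls A T b x * B.meanDiff a b ^ 2) ∂P := by
    rw [integral_add i3 (i4.const_mul _), integral_const_mul,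
      integral_finsetSum _ fun a _ => (i1 a).mul_const _, integral_finsetSum _ fun a _ =>
        integrable_finsetSum _ fun b _ => (i2 a b).mul_const _, Bandit.intermediateRegret]
    congr 1
    · exact Finset.sum_congr rfl fun a _ => (integral_mul_const _ _).symm
    · congr 1
      refine Finset.sum_congr rfl fun a _ => ?_
      rw [integral_finsetSum _ fun b _ => (i2 a b).mul_const _]
      refine Finset.sum_congr (by congr!) fun b _ => (integral_mul_const _ _).symm
  have hcount : ∑ t ∈ Finset.range T, (if t < m then (1 : ℝ) else 0) ≤ m := by
    rw [Finset.sum_boole]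
    have : (Finset.range T).filter (fun t => t < m) ⊆ Finset.range m := fun t ht =>
      Finset.mem_range.2 (Finset.mem_filter.1 ht).2
    exact_mod_cast (Finset.card_le_card this).trans (Finset.card_range m).le
  have hpt : ∀ x, ∑ a, pulls A T a x * B.mvDiff ρ a aStar +
        (1 / (T : ℝ)) * ∑ a, ∑ b ∈ Finset.univ.filter (fun b => b ≠ a),
          pulls A T a x * pulls A T b x * B.meanDiff a b ^ 2 ≤
      (w + 2 * ρ + 8) * m + T * D x := by
    intro x
    have h1 : ∑ a, pulls A T a x * B.mvDiff ρ a aStar ≤ (w + 2 * ρ) * m + T * D x := by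
      rw [sum_pulls_mul A T (fun a => B.mvDiff ρ a aStar)]
      have : ∀ t ∈ Finset.range T, B.mvDiff ρ (A t x) aStar ≤
          (w + 2 * ρ) * (if t < m then 1 else 0) + D x := by
        intro t ht
        split_ifs with h
        · linarith [Bandit.mvDiff_le hρ hw (A t x) aStar, hD0 x]
        · linarith [hgap t x (not_lt.1 h) (Finset.mem_range.1 ht)]
      refine (Finset.sum_le_sum this).trans ?_
      rw [Finset.sum_add_distrib, ← Finset.mul_sum, Finset.sum_const, Finset.card_range,
        nsmul_eq_mul]
      gcongr
    -- The diagonal `b = a` may be added because `Γ_{a,a} = 0`; the sum then runs over pairs of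
    -- rounds.
    have h2 : ∑ a, ∑ b ∈ Finset.univ.filter (fun b => b ≠ a),
        pulls A T a x * pulls A T b x * B.meanDiff a b ^ 2 =
        ∑ s ∈ Finset.range T, ∑ t ∈ Finset.range T, B.meanDiff (A s x) (A t x) ^ 2 := by
      rw [← sum_pulls_mul A T
        (fun a => ∑ t ∈ Finset.range T, B.meanDiff a (A t x) ^ 2)]
      refine Finset.sum_congr rfl fun a _ => ?_
      rw [← sum_pulls_mul A T (fun b => B.meanDiff a b ^ 2), Finset.mul_sum]
      refine Finset.sum_subset_zero_on_sdiff (Finset.subset_univ _) (fun b hb => ?_)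
        (fun b _ => by ring)
      have : b = a := by simpa using hb
      simp [this, Bandit.meanDiff]
    have h3 : ∑ s ∈ Finset.range T, ∑ t ∈ Finset.range T, B.meanDiff (A s x) (A t x) ^ 2 ≤
        8 * m * T := by
      have : ∀ s ∈ Finset.range T, ∀ t ∈ Finset.range T, B.meanDiff (A s x) (A t x) ^ 2 ≤
          4 * (if s < m then 1 else 0) + 4 * (if t < m then 1 else 0) := by
        intro s hs t ht
        have h4 := B.meanDiff_sq_le (A s x) (A t x)
        split_ifs with h5 h6 h6
        · linarith
        · linarith
        · linarith
        · rw [hconst s t x (not_lt.1 h5) (Finset.mem_range.1 hs) (not_lt.1 h6)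
            (Finset.mem_range.1 ht)]
          simp [Bandit.meanDiff]
      refine (Finset.sum_le_sum fun s hs => Finset.sum_le_sum fun t ht => this s hs t ht).trans ?_
      simp only [Finset.sum_add_distrib, ← Finset.mul_sum, Finset.sum_const, Finset.card_range,
        nsmul_eq_mul]
      nlinarith
    rw [h2]
    have h4 : (1 / (T : ℝ)) * ∑ s ∈ Finset.range T, ∑ t ∈ Finset.range T,
        B.meanDiff (A s x) (A t x) ^ 2 ≤ 8 * m := by
      rw [one_div, inv_mul_le_iff₀ hT']
      linarith
    linarith
  rw [hR]
  refine (integral_mono (i3.add (i4.const_mul _)) ((integrable_const _).add (hD.const_mul _))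
    hpt).trans (le_of_eq ?_)
  change ∫ x, ((w + 2 * ρ + 8) * m + T * D x) ∂P = _
  rw [integral_add (integrable_const _) (hD.const_mul _), integral_const_mul (T : ℝ), integral_const]
  simp

end Regret

/-! ### Runs of RISE -/

section Run

variable {d n : ℕ} {B : Bandit d} {Ω : Type*} {η : ℕ → B.actions → Ω → ℝ} {ρ : ℝ}
  {e : ℕ → B.actions} {sel : (B.actions → ℝ) → B.actions} {A : ℕ → Ω → B.actions}
  {X : ℕ → Ω → ℝ}

/-- The data of the exploration phase. -/
def exploreData {α : Type*} (n : ℕ) (e : ℕ → α) (X : ℕ → Ω → ℝ) (x : Ω) (s : Fin n) : α × ℝ :=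
  (e s, X s x)

/-- The action to which RISE commits after the exploration phase. -/
def commitAction (ρ : ℝ) (n : ℕ) (e : ℕ → B.actions) (sel : (B.actions → ℝ) → B.actions)
    (X : ℕ → Ω → ℝ) (x : Ω) : B.actions :=
  sel fun a => ⟪phiHat B.ω (exploreData n e X x) - ρ • thetaHat (exploreData n e X x),
    (a : Vec d)⟫

theorem Bandit.IsRun.action_of_lt (h : B.IsRun η (rise B.ω ρ n e sel) A X) {t : ℕ} (ht : t < n)
    (x : Ω) : A t x = e t := by
  rw [h.action, rise, dif_pos ht]

theorem Bandit.IsRun.action_of_le (h : B.IsRun η (rise B.ω ρ n e sel) A X) {t : ℕ} (ht : n ≤ t)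
    (x : Ω) : A t x = commitAction ρ n e sel X x := by
  have hdata : (fun s : Fin n => (A s x, X s x)) = exploreData n e X x := by
    funext s
    rw [exploreData, h.action_of_lt s.2]
  rw [h.action, rise, dif_neg (not_lt.2 ht), commitAction, ← hdata]
  rfl

theorem Bandit.IsRun.reward_of_lt (h : B.IsRun η (rise B.ω ρ n e sel) A X) {t : ℕ} (ht : t < n)
    (x : Ω) : X t x = B.mean (e t) + η t (e t) x := by
  rw [h.reward, h.action_of_lt ht]

variable [MeasurableSpace Ω] {P : Measure Ω}

theorem Bandit.IsRun.measurable_reward (h : B.IsRun η (rise B.ω ρ n e sel) A X)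
    (hη : B.IsNoise P η) {t : ℕ} (ht : t < n) : Measurable (X t) := by
  rw [show X t = fun x => B.mean (e t) + η t (e t) x from funext (h.reward_of_lt ht)]
  exact (hη.measurable t (e t)).const_add _

theorem measurable_inner_leastSquares {y : Fin n → Ω → ℝ} (hy : ∀ s, Measurable (y s))
    (u : Vec d) :
    Measurable fun x => ⟪leastSquares (exploreData n e X x) (fun s => y s x), u⟫ := by
  have hp : ∀ x, points (exploreData n e X x) = fun s : Fin n => (e s : Vec d).ofLp :=
    fun _ => rfl
  simp only [inner_leastSquares, hp]
  exact Finset.measurable_sum _ fun s _ => (hy s).mul_const _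

theorem Bandit.IsRun.measurable_commitAction (h : B.IsRun η (rise B.ω ρ n e sel) A X)
    (hη : B.IsNoise P η) (hsel : IsArgmin sel) :
    Measurable (commitAction (B := B) ρ n e sel X) := by
  have hX : ∀ s : Fin n, Measurable (X s) := fun s => h.measurable_reward hη s.2
  refine hsel.measurable.comp (measurable_pi_lambda _ fun a => ?_)
  simp only [inner_sub_left, real_inner_smul_left]
  refine Measurable.sub ?_ (Measurable.const_mul ?_ _)
  · refine measurable_inner_leastSquares (fun s => ?_) _
    refine Measurable.sub_const (Measurable.pow_const (Measurable.sub (hX s) ?_) _) _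
    exact measurable_inner_leastSquares hX (e s : Vec d)
  · exact measurable_inner_leastSquares hX _

theorem Bandit.IsRun.measurable_action (h : B.IsRun η (rise B.ω ρ n e sel) A X)
    (hη : B.IsNoise P η) (hsel : IsArgmin sel) (t : ℕ) : Measurable (A t) := by
  rcases lt_or_ge t n with ht | ht
  · rw [show A t = fun _ => e t from funext (h.action_of_lt ht)]
    exact measurable_const
  · rw [show A t = commitAction ρ n e sel X from funext (h.action_of_le ht)]
    exact h.measurable_commitAction hη hsel

/-- The exploration order is deterministic, so the observed noises are fixed coordinates of
independent vectors. -/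
theorem Bandit.IsNoise.iIndepFun_explore (hη : B.IsNoise P η) (n : ℕ) (e : ℕ → B.actions) :
    iIndepFun (fun (s : Fin n) x => η s (e s) x) P :=
  (hη.indep.comp (fun t f => f (e t)) fun t => measurable_pi_apply (e t)).precomp
    Fin.val_injective

end Run

/-! ### Regret of RISE for general parameters -/

theorem errorBound_nonneg {ι : Type*} [Fintype ι] {ρ : ℝ} (hρ : 0 ≤ ρ) {H : ι → ι → ℝ}
    (hH : ∀ s, 0 ≤ H s s) (v z : ι → ℝ) : 0 ≤ errorBound ρ H v z := by
  have h1 : ∀ s, 0 ≤ H s s * z s ^ 2 := fun s => mul_nonneg (hH s) (sq_nonneg _)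
  unfold errorBound
  have : 0 ≤ ∑ s, (H s s * z s ^ 2 + 2 * (∑ i, H s i * z i) ^ 2) :=
    Finset.sum_nonneg fun s _ => add_nonneg (h1 s) (by positivity)
  positivity

/-- The constant in the bound for the expected estimation error. -/
def errorConst (ρ w : ℝ) : ℝ := ρ * (1 + w) + (1 + gaussianFourthMoment * w ^ 2) + 3 * w

theorem errorConst_nonneg {ρ w : ℝ} (hρ : 0 ≤ ρ) (hw : 0 ≤ w) : 0 ≤ errorConst ρ w := by
  have := gaussianFourthMoment_nonneg
  unfold errorConst
  positivity

section Rise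

variable {d : ℕ} {B : Bandit d} {Ω : Type*} [MeasurableSpace Ω] {P : Measure Ω}
  [IsProbabilityMeasure P] {η : ℕ → B.actions → Ω → ℝ} {ρ C δ ε w : ℝ} {Q : B.actions → ℝ}
  {e : ℕ → B.actions} {sel : (B.actions → ℝ) → B.actions} {A : ℕ → Ω → B.actions}
  {X : ℕ → Ω → ℝ}

/-- The regret of RISE before the parameters are tuned. -/
theorem intermediateRegret_rise_le (hd : 0 < d) (hρ : 0 ≤ ρ) (hw : ∀ a, B.var a ≤ w)
    (aStar : B.actions) (hN : 0 < exploreScale d C δ ε) (hQ : IsDesign Q)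
    (he : IsExploreOrder C δ ε Q e) (hsel : IsArgmin sel) (hη : B.IsNoise P η)
    (hrun : B.IsRun η (rise B.ω ρ (exploreLength C δ ε Q) e sel) A X) {M : ℝ} (hM : 0 ≤ M)
    (hNM : (exploreScale d C δ ε)⁻¹ ≤ M ^ 2) {T : ℕ} (hT : 0 < T) :
    B.intermediateRegret P ρ aStar A T ≤ (w + 2 * ρ + 8) * exploreLength C δ ε Q +
      T * (2 * M * (errorConst ρ w * d)) := by
  set n := exploreLength C δ ε Q
  set v : Fin n → Fin d → ℝ := fun s => (e s : Vec d).ofLp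
  set z : Fin n → Ω → ℝ := fun s x => η s (e s) x
  have hw0 : 0 ≤ w := (B.var_nonneg aStar).trans (hw aStar)
  -- A sample point is needed only to form exploration data; their Gram matrix does not depend on
  -- it.
  by_cases hΩ : Nonempty Ω
  swap
  · exfalso
    have h1 : P Set.univ = 1 := measure_univ
    rw [not_nonempty_iff] at hΩ
    rw [Set.eq_empty_of_isEmpty Set.univ, measure_empty] at h1
    exact zero_ne_one h1
  have hV : IsUnit (wgram 1 v) := by
    have := he.isUnit_wgram hd hN hQ (h := exploreData n e X hΩ.some) (fun _ => rfl)
    exact this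
  set E : Ω → ℝ := fun x => errorBound ρ (hat v) (fun s => B.var (e s)) fun s => z s x
  have hzm : ∀ s, Measurable (z s) := fun s => hη.measurable s (e s)
  have hzl : ∀ s, P.map (z s) = gaussianReal 0 (B.var (e s)).toNNReal := fun s => hη.law s (e s)
  have hEi : Integrable E P := integrable_errorBound hzm hzl
  have hEb := integral_errorBound_le hρ hzm hzl (hη.iIndepFun_explore n e)
    (fun s => B.var_nonneg (e s)) (fun s => hw (e s)) (sum_hat_sq hV) (sum_hat_diag hV)
  have hE0 : ∀ x, 0 ≤ E x := fun x => errorBound_nonneg hρ (hat_diag_nonneg hV) _ _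
  have hd1 : (1 : ℝ) ≤ d := by exact_mod_cast hd
  have hEb' : ∫ x, E x ∂P ≤ errorConst ρ w * d := by
    refine hEb.trans ?_
    unfold errorConst
    nlinarith
  -- If exploration is cut off, that is `T < n`, the conditions on rounds `n ≤ t < T` are vacuous
  -- and the bound still holds.
  refine (B.intermediateRegret_le (P := P) hρ hw aStar
    (fun t => hrun.measurable_action hη hsel t) hT n (D := fun x => 2 * M * E x)
    (hEi.const_mul _) (fun x => by have := hE0 x; positivity) ?_ ?_).trans ?_
  · intro t x ht _
    rw [hrun.action_of_le ht]
    exact mvDiff_sel_le hρ hV (h := exploreData n e X x) (z := fun s => z s x)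
      (fun s => hrun.reward_of_lt s.2 x) hM
      (fun a => (he.leverage_le hd hN hQ (h := exploreData n e X x) (fun _ => rfl) a).trans hNM)
      hsel aStar
  · intro s t x hs _ ht _
    rw [hrun.action_of_le hs, hrun.action_of_le ht]
  · rw [integral_const_mul]
    gcongr

theorem intermediateRegret_rise_le_horizon (hρ : 0 ≤ ρ) (hw : ∀ a, B.var a ≤ w)
    (aStar : B.actions) (hA : ∀ t, Measurable (A t)) {T : ℕ} (hT : 0 < T) :
    B.intermediateRegret P ρ aStar A T ≤ (w + 2 * ρ + 8) * T := by
  have := B.intermediateRegret_le (P := P) hρ hw aStar hA hT T (D := fun _ => 0)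
    (integrable_const _) (fun _ => le_rfl) (fun t x h1 h2 => absurd h1 (not_le.2 h2))
    (fun s t x h1 h2 => absurd h1 (not_le.2 h2))
  simpa using this

end Rise

/-! ### Tuning of the parameters -/

theorem exploreScale_pos {d T : ℕ} {C ε : ℝ} (hd : 2 ≤ d) (hT : 2 ≤ T) (hC : 0 < C)
    (hε : 0 < ε) : 0 < exploreScale d C (T : ℝ)⁻¹ ε := by
  have h1 : 0 < Real.log d := Real.log_pos (by exact_mod_cast hd)
  have h2 : 0 < Real.log T := Real.log_pos (by exact_mod_cast hT)
  have h3 : (0 : ℝ) < d := by positivity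
  rw [exploreScale, inv_inv]
  positivity

/-- The powers of `d` in `d²/ε²` cancel and leave `T^{2/3}`. The assumption on `d` turns `log d`
into a third factor `log T`. -/
theorem exploreScale_mul_le {d T : ℕ} {C ε c : ℝ} (hd : 2 ≤ d) (hT : 2 ≤ T) (hc : 0 < c)
    (hε : c * (d * (T : ℝ) ^ (-(1 / 3) : ℝ)) ≤ ε) (hdT : (d : ℝ) ≤ (T : ℝ) ^ (2 / 3 : ℝ)) :
    exploreScale d C (T : ℝ)⁻¹ ε * d ≤
      C ^ 2 / c ^ 2 * (d * (T : ℝ) ^ (2 / 3 : ℝ)) * Real.log T ^ 3 := by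
  have hT1 : (1 : ℝ) ≤ T := by exact_mod_cast (by omega : 1 ≤ T)
  have hT0 : (0 : ℝ) < T := by linarith
  have hd0 : (0 : ℝ) < d := by positivity
  have hL : 0 < Real.log T := Real.log_pos (by exact_mod_cast hT)
  have hdT' : (d : ℝ) ≤ T := hdT.trans (by
    conv_rhs => rw [← Real.rpow_one T]
    exact Real.rpow_le_rpow_of_exponent_le hT1 (by norm_num))
  have hlog : Real.log d ≤ Real.log T := Real.log_le_log hd0 hdT'
  set y := (T : ℝ) ^ (-(1 / 3) : ℝ) with hy
  have hy0 : 0 < y := Real.rpow_pos_of_pos hT0 _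
  have hyy : (T : ℝ) ^ (2 / 3 : ℝ) * y ^ 2 = 1 := by
    rw [hy, ← Real.rpow_natCast, ← Real.rpow_mul hT0.le, ← Real.rpow_add hT0]
    norm_num
  have hε2 : (c * (d * y)) ^ 2 ≤ ε ^ 2 := by gcongr
  have hpos : 0 < (c * (d * y)) ^ 2 := by positivity
  rw [exploreScale, inv_inv]
  calc C ^ 2 * (d : ℝ) ^ 2 * Real.log d * Real.log T ^ 2 / ε ^ 2 * d
      ≤ C ^ 2 * (d : ℝ) ^ 2 * Real.log T * Real.log T ^ 2 / (c * (d * y)) ^ 2 * d := by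
        gcongr
    _ = C ^ 2 / c ^ 2 * (d * (1 / y ^ 2)) * Real.log T ^ 3 := by
        field_simp
    _ = _ := by rw [← hyy, mul_div_assoc, div_self (by positivity), mul_one]

/-- The constant `1 / (C log 2 √(log 2))`. -/
def radiusConst (C : ℝ) : ℝ := 1 / (C * Real.log 2 * √(Real.log 2))

theorem radiusConst_nonneg {C : ℝ} (hC : 0 < C) : 0 ≤ radiusConst C := by
  have : 0 < Real.log 2 := Real.log_pos one_lt_two
  unfold radiusConst
  positivity

/-- Both logarithms are at least `log 2`, which is all that `radiusConst` retains of them. -/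
theorem exploreScale_inv_le {d T : ℕ} {C ε c : ℝ} (hd : 2 ≤ d) (hT : 2 ≤ T) (hC : 0 < C)
    (hε0 : 0 < ε) (hε : ε ≤ c * (d * (T : ℝ) ^ (-(1 / 3) : ℝ))) :
    (exploreScale d C (T : ℝ)⁻¹ ε)⁻¹ ≤ (radiusConst C * c * (T : ℝ) ^ (-(1 / 3) : ℝ)) ^ 2 := by
  have hd0 : (0 : ℝ) < d := by positivity
  have h2 : 0 < Real.log 2 := Real.log_pos one_lt_two
  have hLd : Real.log 2 ≤ Real.log d := Real.log_le_log two_pos (by exact_mod_cast hd)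
  have hLT : Real.log 2 ≤ Real.log T := Real.log_le_log two_pos (by exact_mod_cast hT)
  set y := (T : ℝ) ^ (-(1 / 3) : ℝ) with hy
  rw [exploreScale, inv_inv, inv_div]
  calc ε ^ 2 / (C ^ 2 * (d : ℝ) ^ 2 * Real.log d * Real.log T ^ 2)
      ≤ (c * (d * y)) ^ 2 / (C ^ 2 * (d : ℝ) ^ 2 * Real.log 2 * Real.log 2 ^ 2) := by gcongr
    _ = _ := by
        rw [radiusConst, mul_pow, mul_pow (1 / _ * c), mul_pow (1 / _), div_pow, mul_pow (C * _),
          Real.sq_sqrt h2.le]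
        field_simp

end MVBandit

end

/-! ### The regret bound with tuned parameters -/

theorem mainTheorem5 :
    -- the exponent of the logarithm is absolute
    ∃ k : ℕ,
    -- the constant depends on the risk tolerance, the variance bound, the constant in the
    -- exploration counts, and the constants in `ε = Θ(d T^{-1/3})`
    ∀ ρ σmax Ctilde c₁ c₂ : ℝ, 0 ≤ ρ → 0 ≤ σmax → 0 < Ctilde → 0 < c₁ → c₁ ≤ c₂ →
    ∃ C : ℝ, 0 < C ∧
    ∀ (d T : ℕ), 2 ≤ d → 2 ≤ T →
    ∀ ε : ℝ, c₁ * (d * (T : ℝ) ^ (-(1 / 3) : ℝ)) ≤ ε → ε ≤ c₂ * (d * (T : ℝ) ^ (-(1 / 3) : ℝ)) →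
    ∀ (B : MVBandit.Bandit d), (∀ a, B.var a ≤ σmax ^ 2) →
    ∀ (aStar : B.actions), (∀ a, B.mv ρ aStar ≤ B.mv ρ a) →
    -- the ingredients of the algorithm, with `δ = 1 / T`
    ∀ (Q : B.actions → ℝ), MVBandit.IsGOptimal Q →
    ∀ (e : ℕ → B.actions), MVBandit.IsExploreOrder Ctilde (T : ℝ)⁻¹ ε Q e →
    ∀ (sel : (B.actions → ℝ) → B.actions), MVBandit.IsArgmin sel →
    -- the interaction of the algorithm with the environment
    ∀ (Ω : Type*) [MeasurableSpace Ω] (P : Measure Ω) [IsProbabilityMeasure P]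
      (η : ℕ → B.actions → Ω → ℝ), B.IsNoise P η →
    ∀ (A : ℕ → Ω → B.actions) (X : ℕ → Ω → ℝ),
      B.IsRun η
        (MVBandit.rise B.ω ρ (MVBandit.exploreLength Ctilde (T : ℝ)⁻¹ ε Q) e sel) A X →
    B.intermediateRegret P ρ aStar A T ≤
      C * (d * (T : ℝ) ^ (2 / 3 : ℝ)) * Real.log T ^ k := by
  refine ⟨3, fun ρ σmax Ct c₁ c₂ hρ hσ hCt hc₁ hc₁₂ => ?_⟩
  have hc₂ : 0 < c₂ := hc₁.trans_le hc₁₂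
  have hl2 : 0 < Real.log 2 := Real.log_pos one_lt_two
  set K := σmax ^ 2 + 2 * ρ + 8
  have hK0 : 0 < K := by positivity
  set R := 2 * (MVBandit.radiusConst Ct * c₂) * MVBandit.errorConst ρ (σmax ^ 2) with hR
  have hr0 := MVBandit.radiusConst_nonneg hCt
  have hR0 : 0 ≤ R := by
    have := MVBandit.errorConst_nonneg hρ (sq_nonneg σmax)
    positivity
  -- The first summand pays for `N d` exploration rounds. The second pays for rounding, for
  -- commitment and for the case of large `d`; these carry no logarithm, whence the division by
  -- `log³ 2`.
  refine ⟨K * (Ct ^ 2 / c₁ ^ 2) + (K + R) / Real.log 2 ^ 3, by positivity, ?_⟩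
  intro d T hd hT ε hε₁ hε₂ B hvar aStar _ Q hQ e he sel hsel Ω _ P _ η hη A X hrun
  have hT1 : (1 : ℝ) ≤ T := by exact_mod_cast (by omega : 1 ≤ T)
  have hT0 : (0 : ℝ) < T := by linarith
  have hL2 : Real.log 2 ≤ Real.log T := Real.log_le_log two_pos (by exact_mod_cast hT)
  have hL0 : 0 < Real.log T := hl2.trans_le hL2
  have hL3 : 1 ≤ Real.log T ^ 3 / Real.log 2 ^ 3 := by
    rw [one_le_div (by positivity)]
    gcongr
  set S := (T : ℝ) ^ (2 / 3 : ℝ) with hS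
  have hS0 : 0 < S := Real.rpow_pos_of_pos hT0 _
  have hdS : (d : ℝ) * S ≤ (d * S) * (Real.log T ^ 3 / Real.log 2 ^ 3) :=
    le_mul_of_one_le_right (by positivity) hL3
  have hmain0 : 0 ≤ K * (Ct ^ 2 / c₁ ^ 2) * (d * S) * Real.log T ^ 3 := by positivity
  have hgoal : (K * (Ct ^ 2 / c₁ ^ 2) + (K + R) / Real.log 2 ^ 3) * (d * S) * Real.log T ^ 3 =
      K * (Ct ^ 2 / c₁ ^ 2) * (d * S) * Real.log T ^ 3 +
        (K + R) * ((d * S) * (Real.log T ^ 3 / Real.log 2 ^ 3)) := by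
    ring
  rw [hgoal]
  have hKR := mul_le_mul_of_nonneg_left hdS (add_nonneg hK0.le hR0)
  have hε0 : 0 < ε := lt_of_lt_of_le (by positivity) hε₁
  -- For `d ≤ T^{2/3}` the rounding cost `d²` is at most `dT^{2/3}`. For larger `d` the linear bound
  -- suffices, since `T ≤ T^{4/3} ≤ dT^{2/3}`.
  rcases le_or_gt (d : ℝ) S with hdT | hdT
  · have hN := MVBandit.exploreScale_pos hd hT hCt hε0
    have h1 := MVBandit.intermediateRegret_rise_le (P := P) (by omega : 0 < d) hρ hvar aStar hN
      hQ.isDesign he hsel hη hrun (M := MVBandit.radiusConst Ct * c₂ * (T : ℝ) ^ (-(1 / 3) : ℝ))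
      (by positivity) (MVBandit.exploreScale_inv_le hd hT hCt hε0 hε₂) (by omega : 0 < T)
    have h2 := MVBandit.exploreLength_le hN.le hQ
    have h3 := mul_le_mul_of_nonneg_left (hQ.gValue_le (by omega)) hN.le
    have h4 := MVBandit.exploreScale_mul_le (C := Ct) hd hT hc₁ hε₁ hdT
    have h5 : (d : ℝ) ^ 2 ≤ d * S := by rw [sq]; gcongr
    have h6 : K * (MVBandit.exploreLength Ct (T : ℝ)⁻¹ ε Q : ℝ) ≤
        K * (Ct ^ 2 / c₁ ^ 2 * (d * S) * Real.log T ^ 3 + d * S) := by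
      gcongr
      linarith
    have h7 : (T : ℝ) * (2 * (MVBandit.radiusConst Ct * c₂ * (T : ℝ) ^ (-(1 / 3) : ℝ)) *
        (MVBandit.errorConst ρ (σmax ^ 2) * d)) = R * (d * S) := by
      have : (T : ℝ) * (T : ℝ) ^ (-(1 / 3) : ℝ) = S := by
        rw [hS]
        nth_rewrite 1 [← Real.rpow_one T]
        rw [← Real.rpow_add hT0]
        norm_num
      rw [← this, hR]
      ring
    rw [h7] at h1
    linarith
  · have h1 := MVBandit.intermediateRegret_rise_le_horizon (P := P) hρ hvar aStar
      (hrun.measurable_action hη hsel) (by omega : 0 < T)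
    have h2 : (T : ℝ) ≤ d * S := by
      calc (T : ℝ) = (T : ℝ) ^ (1 : ℝ) := (Real.rpow_one _).symm
        _ ≤ (T : ℝ) ^ (2 / 3 + 2 / 3 : ℝ) :=
            Real.rpow_le_rpow_of_exponent_le hT1 (by norm_num)
        _ = S * S := Real.rpow_add hT0 _ _
        _ ≤ d * S := by gcongr
    have h3 := mul_le_mul_of_nonneg_left h2 hK0.le
    have h4 : 0 ≤ R * (d * S) := by positivity
    linarith
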